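/- Consider the two-stage robust optimization problem with decision-dependent uncertainty $$w^*=\min_{\mathbf x\in\mathcal X}\ \mathbf c_1\mathbf x+\max_{\mathbf u\in\mathcal U(\mathbf x)}\ \min_{\mathbf y\in\mathcal Y(\mathbf x,\mathbf u)}\mathbf c_2\mathbf y ,$$ where $\mathcal X=\{\mathbf x\in\mathbb Z_+^{m_x}\times\mathbb R_+^{n_x}:\mathbf A\mathbf x\ge\mathbf b\}$, $\mathcal U(\mathbf x)=\{\mathbf u\in\mathbb R_+^{n_u}:\mathbf F(\mathbf x)\mathbf u\le\mathbf h+\mathbf G\mathbf x\}$, $\mathcal Y(\mathbf x,\mathbf u)=\{\mathbf y\in\mathbb R_+^{n_y}:\mathbf B_2\mathbf y\ge\mathbf d-\mathbf B_1\mathbf x-\mathbf E\mathbf u\}$, and $\mathbf B_2$ has $\mu_y$ rows. An infeasible minimization has value $+\infty$. Call $\mathbf x\in\mathcal X$ feasible if $\mathcal Y(\mathbf x,\mathbf u)\ne\emptyset$ for all $\mathbf u\in\mathcal U(\mathbf x)$; the problem is infeasible if no $\mathbf x\in\mathcal X$ is feasible. Assume that $\mathcal U(\mathbf x)$ is non-empty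 and bounded for every $\mathbf x\in\mathcal X$, and that $\min\{\mathbf c_1\mathbf x+\mathbf c_2\mathbf y:\mathbf x\in\mathcal X,\mathbf u\in\mathcal U(\mathbf x),\mathbf y\in\mathcal Y(\mathbf x,\mathbf u)\}$ has a finite optimal value (is feasible and bounded below). Let $\Pi=\{\boldsymbol\pi\ge\mathbf 0:\mathbf B_2^\intercal\boldsymbol\pi\le\mathbf c_2^\intercal\}$, and let $\mathcal P_\Pi$ and $\mathcal R_\Pi$ be its sets of extreme points and of extreme rays (each ray represented by its vector with coordinate sum $1$). For $\boldsymbol\beta\in\mathbb R^{\mu_y}$ let $\mathcal O(\mathbf x,\boldsymbol\beta)$ be the set of pairs $(\mathbf u,\boldsymbol\lambda)$ satisfying the KKT conditions of $\max\{(-\mathbf E\mathbf u)^\intercal\boldsymbol\beta:\mathbf u\in\mathcal U(\mathbf x)\}$; it is written $\mathcal{OU}$ if $\boldsymbol\beta\in\mathcal P_\Pi$ and $\mathcal{OV}$ if $\boldsymbol\beta\in\mathcal R_\Pi$. The parametric C\&CG algorithm with $TOL=0$ starts with $LB=-\infty$, $UB=+\infty$, $\hat{\mathcal P}=\hat{\mathcal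 R}=\emptyset$. Each iteration does the following. 1. Solve the master problem: minimize $\mathbf c_1\mathbf x+\eta$ over $\mathbf x\in\mathcal X$, $\eta\in\mathbb R$ and one recourse replicate for every scenario set, namely $(\mathbf u^{\boldsymbol\pi},\boldsymbol\lambda^{\boldsymbol\pi})\in\mathcal{OU}(\mathbf x,\boldsymbol\pi)$, $\mathbf y^{\boldsymbol\pi}\in\mathcal Y(\mathbf x,\mathbf u^{\boldsymbol\pi})$, $\eta\ge\mathbf c_2\mathbf y^{\boldsymbol\pi}$ for every $\boldsymbol\pi\in\hat{\mathcal P}$, and $(\mathbf v^{\boldsymbol\gamma},\boldsymbol\zeta^{\boldsymbol\gamma})\in\mathcal{OV}(\mathbf x,\boldsymbol\gamma)$, $\mathbf y^{\boldsymbol\gamma}\in\mathcal Y(\mathbf x,\mathbf v^{\boldsymbol\gamma})$ for every $\boldsymbol\gamma\in\hat{\mathcal R}$ (in the unified form also $\eta\ge\mathbf c_2\mathbf y^{\boldsymbol\gamma}$; the result covers both forms). If it is infeasible, report infeasibility and stop. Otherwise let $LB$ be its optimal value and $\mathbf x^*$ the first-stage part of an optimal solution (of any feasible solution if the value is $-\infty$).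 2. Compute $\eta_f(\mathbf x^*)=\max_{\mathbf u\in\mathcal U(\mathbf x^*)}\min\{\mathbf 1^\intercal\tilde{\mathbf y}:\mathbf B_2\mathbf y+\tilde{\mathbf y}\ge\mathbf d-\mathbf B_1\mathbf x^*-\mathbf E\mathbf u,\ \mathbf y,\tilde{\mathbf y}\ge\mathbf 0\}$ with a maximizer $\mathbf u_f^*$. If $\eta_f(\mathbf x^*)=0$, compute $\eta_s(\mathbf x^*)=\max_{\mathbf u\in\mathcal U(\mathbf x^*)}\min\{\mathbf c_2\mathbf y:\mathbf y\in\mathcal Y(\mathbf x^*,\mathbf u)\}$, a maximizer $\mathbf u_s^*$ and an optimal dual solution $\boldsymbol\pi^*\in\mathcal P_\Pi$ of the recourse problem at $(\mathbf x^*,\mathbf u_s^*)$, and add $\boldsymbol\pi^*$ to $\hat{\mathcal P}$. If $\eta_f(\mathbf x^*)>0$, set $\eta_s(\mathbf x^*)=+\infty$, find $\boldsymbol\gamma^*\in\mathcal R_\Pi$ with $(\mathbf d-\mathbf B_1\mathbf x^*-\mathbf E\mathbf u_f^*)^\intercal\boldsymbol\gamma^*>0$, and add it to $\hat{\mathcal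 R}$. 3. Set $UB:=\min\{UB,\mathbf c_1\mathbf x^*+\eta_s(\mathbf x^*)\}$ and keep a first-stage decision, found in this or an earlier iteration, that attains $UB$. If $UB-LB\le 0$, return that decision and stop; otherwise start the next iteration. Then, for every choice of the solutions returned in these steps: (a) If the algorithm reports infeasibility, the two-stage problem is infeasible. If it stops in step 3, then $LB=UB=w^*$ is finite and the returned decision is an optimal first-stage solution. (b) There is no infinite execution, and in every iteration that is reached and whose master problem can be solved exactly (it is infeasible, unbounded, or attains its minimum) all steps can be carried out. So if all master problems that arise can be solved exactly, the algorithm stops in one of the two ways of (a). (c) $\mathcal P_\Pi$ and $\mathcal R_\Pi$ are finite, and the number of iterations before the terminating one is at most $|\mathcal P_\Pi|+|\mathcal R_\Pi|$. Moreover $$|\mathcal P_\Pi|+|\mathcal R_\Pi|\le\Bigl(1+\frac{\mu_y}{n_y+1}\Bigr)\binom{n_y+\mu_y}{\mu_y},$$ so the iteration complexity is $O\bigl(\binom{n_y+\mu_y}{\mu_y}\bigr)$ for fixed $\mu_y$, and more generally while $\mu_y=O(n_y+1)$. If every $\mathbf x\in\mathcal X$ is feasible, the number of iterations before the terminating one is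 at most $|\mathcal P_\Pi|$; and $|\mathcal P_\Pi|\le\binom{n_y+\mu_y}{\mu_y}$ always. -/

import Mathlib

open scoped Matrix

namespace RobustDDU

/-- Data of a two-stage robust optimization problem with decision-dependent uncertainty, continuous
uncertainty and continuous recourse.  First-stage vectors have `mx` integer and `nx` continuous
coordinates; `kx`, `μu`, `μy` are the numbers of rows of the three constraint systems.  `F` is an
arbitrary matrix-valued function of the first-stage decision. -/
structure Problem (mx nx kx nu μu ny μy : ℕ) where
  A : Matrix (Fin kx) (Fin mx ⊕ Fin nx) ℝ
  b : Fin kx → ℝ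
  c₁ : Fin mx ⊕ Fin nx → ℝ
  F : (Fin mx ⊕ Fin nx → ℝ) → Matrix (Fin μu) (Fin nu) ℝ
  h : Fin μu → ℝ
  G : Matrix (Fin μu) (Fin mx ⊕ Fin nx) ℝ
  c₂ : Fin ny → ℝ
  B₁ : Matrix (Fin μy) (Fin mx ⊕ Fin nx) ℝ
  B₂ : Matrix (Fin μy) (Fin ny) ℝ
  E : Matrix (Fin μy) (Fin nu) ℝ
  d : Fin μy → ℝ

noncomputable section

namespace Problem

variable {mx nx kx nu μu ny μy : ℕ} (p : Problem mx nx kx nu μu ny μy)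

/-! ### The two-stage problem -/

/-- The first-stage feasible set, a mixed-integer polyhedron. -/
def X : Set (Fin mx ⊕ Fin nx → ℝ) :=
  {x | (∀ i, ∃ z : ℤ, x (Sum.inl i) = z) ∧ 0 ≤ x ∧ p.b ≤ p.A *ᵥ x}

/-- The decision-dependent uncertainty set. -/
def U (x : Fin mx ⊕ Fin nx → ℝ) : Set (Fin nu → ℝ) :=
  {u | 0 ≤ u ∧ p.F x *ᵥ u ≤ p.h + p.G *ᵥ x}

/-- Right-hand side `d - B₁ x - E u` of the recourse constraints. -/
def rhs (x : Fin mx ⊕ Fin nx → ℝ) (u : Fin nu → ℝ) : Fin μy → ℝ :=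
  p.d - p.B₁ *ᵥ x - p.E *ᵥ u

/-- The recourse feasible set. -/
def Y (x : Fin mx ⊕ Fin nx → ℝ) (u : Fin nu → ℝ) : Set (Fin ny → ℝ) :=
  {y | 0 ≤ y ∧ p.rhs x u ≤ p.B₂ *ᵥ y}

/-- Optimal value of the recourse problem (`⊤` if it is infeasible). -/
def recourse (x : Fin mx ⊕ Fin nx → ℝ) (u : Fin nu → ℝ) : EReal :=
  ⨅ y ∈ p.Y x u, ((p.c₂ ⬝ᵥ y : ℝ) : EReal)

/-- `η_s(x)`, the worst-case recourse cost of `x` (the value of the subproblem SP2). -/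
def worstCase (x : Fin mx ⊕ Fin nx → ℝ) : EReal :=
  ⨆ u ∈ p.U x, p.recourse x u

/-- Total worst-case cost of `x`. -/
def cost (x : Fin mx ⊕ Fin nx → ℝ) : EReal :=
  ((p.c₁ ⬝ᵥ x : ℝ) : EReal) + p.worstCase x

/-- The optimal value `w*` of the two-stage problem. -/
def optVal : EReal := ⨅ x ∈ p.X, p.cost x

/-- `x ∈ X` is feasible if the recourse problem is feasible in every scenario of `U(x)`. -/
def IsFeasible (x : Fin mx ⊕ Fin nx → ℝ) : Prop :=
  x ∈ p.X ∧ ∀ u ∈ p.U x, (p.Y x u).Nonempty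

/-- The two-stage problem is infeasible if no first-stage decision is feasible. -/
def Infeasible : Prop := ∀ x, ¬ p.IsFeasible x

/-- Optimal first-stage solutions. -/
def IsOptimal (x : Fin mx ⊕ Fin nx → ℝ) : Prop :=
  p.IsFeasible x ∧ p.cost x = p.optVal

/-- (A1): every uncertainty set is non-empty. -/
def A1 : Prop := ∀ x ∈ p.X, (p.U x).Nonempty

/-- (A2): every uncertainty set is bounded. -/
def A2 : Prop := ∀ x ∈ p.X, Bornology.IsBounded (p.U x)

/-- Objective values of the problem in which `x`, `u` and `y` are minimized jointly. -/
def jointValues : Set ℝ :=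
  {w | ∃ x ∈ p.X, ∃ u ∈ p.U x, ∃ y ∈ p.Y x u, w = p.c₁ ⬝ᵥ x + p.c₂ ⬝ᵥ y}

/-- (A3): the joint minimization has a finite optimal value (it is feasible and bounded below). -/
def A3 : Prop := p.jointValues.Nonempty ∧ BddBelow p.jointValues

/-! ### The dual polyhedron -/

/-- The feasible set `Π` of the dual of the recourse problem. -/
def dualSet : Set (Fin μy → ℝ) := {π | 0 ≤ π ∧ p.B₂ᵀ *ᵥ π ≤ p.c₂}

/-- The recession cone of `Π`. -/
def recCone : Set (Fin μy → ℝ) := {γ | 0 ≤ γ ∧ p.B₂ᵀ *ᵥ γ ≤ 0}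

/-- `γ` generates an extreme ray of `Π`: it is a nonzero element of the recession cone that is a sum
of two elements of the cone only if these are multiples of `γ`. -/
def IsExtremeDirection (γ : Fin μy → ℝ) : Prop :=
  γ ∈ p.recCone ∧ γ ≠ 0 ∧
    ∀ α ∈ p.recCone, ∀ β ∈ p.recCone, α + β = γ → ∃ s : ℝ, α = s • γ

/-- The set of extreme points of `Π`. -/
def extPts : Set (Fin μy → ℝ) := Set.extremePoints ℝ p.dualSet

/-- The set of extreme rays of `Π`.  Elements of the recession cone are non-negative, so each ray
contains exactly one vector with coordinate sum `1`, and this vector represents it. -/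
def extRays : Set (Fin μy → ℝ) := {γ | p.IsExtremeDirection γ ∧ ∑ i, γ i = 1}

/-- The sets `OU(x, β)` and `OV(x, β)`: pairs of a scenario and a multiplier that satisfy the KKT
conditions of the linear program `max {(-E u)ᵀ β : u ∈ U(x)}`. -/
def kkt (x : Fin mx ⊕ Fin nx → ℝ) (β : Fin μy → ℝ) : Set ((Fin nu → ℝ) × (Fin μu → ℝ)) :=
  {q | p.F x *ᵥ q.1 ≤ p.h + p.G *ᵥ x ∧
    -(p.Eᵀ *ᵥ β) ≤ (p.F x)ᵀ *ᵥ q.2 ∧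
    q.2 * (p.h + p.G *ᵥ x - p.F x *ᵥ q.1) = 0 ∧
    q.1 * ((p.F x)ᵀ *ᵥ q.2 + p.Eᵀ *ᵥ β) = 0 ∧
    0 ≤ q.1 ∧ 0 ≤ q.2}

end Problem

/-! ### The master problem -/

/-- Variables of the master problem.  The families are indexed by all vectors, but the constraints
only involve the members that belong to the current sets of extreme points and extreme rays. -/
structure MasterPoint (mx nx nu μu ny μy : ℕ) where
  x : Fin mx ⊕ Fin nx → ℝ
  η : ℝ
  -- scenario, multiplier and recourse replicate of an extreme point
  u : (Fin μy → ℝ) → Fin nu → ℝ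
  lam : (Fin μy → ℝ) → Fin μu → ℝ
  y : (Fin μy → ℝ) → Fin ny → ℝ
  -- scenario, multiplier and recourse replicate of an extreme ray
  v : (Fin μy → ℝ) → Fin nu → ℝ
  zeta : (Fin μy → ℝ) → Fin μu → ℝ
  yr : (Fin μy → ℝ) → Fin ny → ℝ

namespace Problem

variable {mx nx kx nu μu ny μy : ℕ} (p : Problem mx nx kx nu μu ny μy)

/-- Feasible set of the master problem MP2 for the sets `P` of extreme points and `R` of extreme
rays.  If `unified` holds, the feasibility cutting sets also carry `η ≥ c₂ y^γ`. -/
def masterSet (unified : Prop) (P R : Set (Fin μy → ℝ)) :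
    Set (MasterPoint mx nx nu μu ny μy) :=
  {z | z.x ∈ p.X ∧
    (∀ π ∈ P, p.c₂ ⬝ᵥ z.y π ≤ z.η ∧ z.y π ∈ p.Y z.x (z.u π) ∧
      (z.u π, z.lam π) ∈ p.kkt z.x π) ∧
    (∀ γ ∈ R, (unified → p.c₂ ⬝ᵥ z.yr γ ≤ z.η) ∧ z.yr γ ∈ p.Y z.x (z.v γ) ∧
      (z.v γ, z.zeta γ) ∈ p.kkt z.x γ)}

/-- Objective of the master problem. -/
def masterObj (z : MasterPoint mx nx nu μu ny μy) : ℝ := p.c₁ ⬝ᵥ z.x + z.η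

/-- Optimal value of the master problem (`⊤` if infeasible, `⊥` if unbounded). -/
def masterVal (unified : Prop) (P R : Set (Fin μy → ℝ)) : EReal :=
  ⨅ z ∈ p.masterSet unified P R, ((p.masterObj z : ℝ) : EReal)

/-- What the oracle for the master problem may return: an optimal solution, or any feasible point
if the master problem is unbounded (as it is when no constraint bounds `η`). -/
def MasterReturns (unified : Prop) (P R : Set (Fin μy → ℝ))
    (z : MasterPoint mx nx nu μu ny μy) : Prop :=
  z ∈ p.masterSet unified P R ∧
    (p.masterVal unified P R = ⊥ ∨ ((p.masterObj z : ℝ) : EReal) = p.masterVal unified P R)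

/-- The master problem can be solved exactly: it is infeasible, unbounded, or attains its minimum. -/
def MasterSolvable (unified : Prop) (P R : Set (Fin μy → ℝ)) : Prop :=
  p.masterSet unified P R = ∅ ∨ ∃ z, p.MasterReturns unified P R z

/-! ### The subproblems -/

/-- Minimal total violation of the recourse constraints at `(x, u)`. -/
def violation (x : Fin mx ⊕ Fin nx → ℝ) (u : Fin nu → ℝ) : EReal :=
  ⨅ q ∈ {q : (Fin ny → ℝ) × (Fin μy → ℝ) |
      0 ≤ q.1 ∧ 0 ≤ q.2 ∧ p.rhs x u ≤ p.B₂ *ᵥ q.1 + q.2},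
    ((∑ i, q.2 i : ℝ) : EReal)

/-- `η_f(x)`, the value of the subproblem SP1. -/
def worstViolation (x : Fin mx ⊕ Fin nx → ℝ) : EReal :=
  ⨆ u ∈ p.U x, p.violation x u

/-- The subproblem phase at the master solution `x`, started from the sets `P`, `R`:
`Subproblem x P R η P' R'` says that it may return the recourse cost `η` and the sets `P'`, `R'`. -/
inductive Subproblem (x : Fin mx ⊕ Fin nx → ℝ) (P R : Set (Fin μy → ℝ)) :
    EReal → Set (Fin μy → ℝ) → Set (Fin μy → ℝ) → Prop
  /-- Case A: SP2 yields a worst-case scenario `u` and an extreme point `π` of `Π` that is an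
  optimal dual solution of the recourse problem at `(x, u)`. -/
  | caseA (u : Fin nu → ℝ) (π : Fin μy → ℝ)
      (hf : p.worstViolation x = 0)
      (hu : u ∈ p.U x) (hopt : p.recourse x u = p.worstCase x)
      (hπ : π ∈ p.extPts) (hdual : ((p.rhs x u ⬝ᵥ π : ℝ) : EReal) = p.worstCase x) :
      Subproblem x P R (p.worstCase x) (insert π P) R
  /-- Case B: SP1 yields a scenario `u` of maximal violation, and SP3 an extreme ray `γ` of `Π`
  along which the dual of the recourse problem at `(x, u)` is unbounded. -/
  | caseB (u : Fin nu → ℝ) (γ : Fin μy → ℝ)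
      (hf : 0 < p.worstViolation x)
      (hu : u ∈ p.U x) (hopt : p.violation x u = p.worstViolation x)
      (hγ : γ ∈ p.extRays) (hray : 0 < p.rhs x u ⬝ᵥ γ) :
      Subproblem x P R ⊤ P (insert γ R)

end Problem

/-! ### The algorithm -/

/-- State at the beginning of an iteration; `k` counts the iterations completed before it. -/
structure State (mx nx μy : ℕ) where
  k : ℕ
  LB : EReal
  UB : EReal
  /-- a first-stage decision that attains `UB`, once there is one -/
  best : Option (Fin mx ⊕ Fin nx → ℝ)
  P : Set (Fin μy → ℝ)
  R : Set (Fin μy → ℝ)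

/-- The algorithm is running, has reported infeasibility, or has stopped with the final bounds and
a first-stage decision.  In the last two cases `k` counts the iterations completed before the
terminating one. -/
inductive Config (mx nx μy : ℕ)
  | running (s : State mx nx μy)
  | reportInfeasible (k : ℕ)
  | solved (k : ℕ) (LB UB : EReal) (x : Fin mx ⊕ Fin nx → ℝ)

/-- Number of iterations that precede a configuration (for a terminal one: that precede the
terminating iteration). -/
def Config.iterations {mx nx μy : ℕ} : Config mx nx μy → ℕ
  | .running s => s.k
  | .reportInfeasible k => k
  | .solved k _ _ _ => k

/-- The initial configuration. -/
def Config.init (mx nx μy : ℕ) : Config mx nx μy :=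
  .running ⟨0, ⊥, ⊤, none, ∅, ∅⟩

/-- Update of the recorded first-stage decision by a decision `x` of cost `w`; ties may be broken
either way. -/
def BestUpdate {α : Type} (UB : EReal) (best : Option α) (x : α) (w : EReal)
    (best' : Option α) : Prop :=
  (w ≤ UB ∧ best' = some x) ∨ (UB ≤ w ∧ best' = best)

namespace Problem

variable {mx nx kx nu μu ny μy : ℕ} (p : Problem mx nx kx nu μu ny μy)

/-- One iteration of the parametric C&CG algorithm with tolerance `tol`.  All choices left to the
oracles are arbitrary. -/
inductive Step (unified : Prop) (tol : ℝ) : Config mx nx μy → Config mx nx μy → Prop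
  | infeasible (s : State mx nx μy)
      (hM : p.masterSet unified s.P s.R = ∅) :
      Step unified tol (.running s) (.reportInfeasible s.k)
  | proceed (s : State mx nx μy) (z : MasterPoint mx nx nu μu ny μy)
      (ηs LB' UB' : EReal) (best' : Option (Fin mx ⊕ Fin nx → ℝ)) (P' R' : Set (Fin μy → ℝ))
      (hM : p.MasterReturns unified s.P s.R z)
      (hLB : LB' = p.masterVal unified s.P s.R)
      (hS : p.Subproblem z.x s.P s.R ηs P' R')
      (hUB : UB' = min s.UB (((p.c₁ ⬝ᵥ z.x : ℝ) : EReal) + ηs))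
      (hbest : BestUpdate s.UB s.best z.x (((p.c₁ ⬝ᵥ z.x : ℝ) : EReal) + ηs) best')
      (hgap : ¬ UB' - LB' ≤ (tol : EReal)) :
      Step unified tol (.running s) (.running ⟨s.k + 1, LB', UB', best', P', R'⟩)
  | terminate (s : State mx nx μy) (z : MasterPoint mx nx nu μu ny μy)
      (ηs LB' UB' : EReal) (x : Fin mx ⊕ Fin nx → ℝ) (P' R' : Set (Fin μy → ℝ))
      (hM : p.MasterReturns unified s.P s.R z)
      (hLB : LB' = p.masterVal unified s.P s.R)
      (hS : p.Subproblem z.x s.P s.R ηs P' R')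
      (hUB : UB' = min s.UB (((p.c₁ ⬝ᵥ z.x : ℝ) : EReal) + ηs))
      (hbest : BestUpdate s.UB s.best z.x (((p.c₁ ⬝ᵥ z.x : ℝ) : EReal) + ηs) (some x))
      (hgap : UB' - LB' ≤ (tol : EReal)) :
      Step unified tol (.running s) (.solved s.k LB' UB' x)

/-- Configurations that some execution of the algorithm reaches. -/
def Reaches (unified : Prop) (tol : ℝ) (c : Config mx nx μy) : Prop :=
  Relation.ReflTransGen (p.Step unified tol) (Config.init mx nx μy) c

end Problem

end

end RobustDDU

/-! The proof rests on one fact about a repeated dual vector. A KKT scenario for `β` is a maximizer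
of `rhs x u ⬝ᵥ β` over `U(x)`, so a master solution with a replicate for `β` already contains the
scenario that is worst for `β`. If SP2 returns an extreme point `π` already in `P`, then `rhs x u ⬝ᵥ
π` is at most its value at the replicate scenario, which by weak duality is at most `c₂ y`, hence at
most `η`, and the bounds meet. If SP1 and SP3 return a ray `γ` already in `R`, the positive value
`rhs x u ⬝ᵥ γ` is bounded by a nonpositive one, a contradiction (`Subproblem.new`). So every
non-terminating iteration consumes a new element of a finite set, and `k` equals the number of
elements consumed.

Correctness is a squeeze. KKT points exist for every `x ∈ X` and every `β`, so feasible decisions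
extend to the master problem, which is therefore a relaxation (`masterVal_le_optVal`); `UB` is
always the cost of a recorded decision or `⊤`.

The cardinality bounds count bases: an extreme point is determined by `μy` independent tight rows
out of `ny + μy`, a normalized extreme ray by `μy - 1` (`finite_and_ncard_le_choose`). That the
subproblems can be carried out follows from LP duality, derived from Farkas' lemma, and compactness.
-/

namespace RobustDDU

/-! ### Linear programming duality -/

/-- **Farkas' lemma** for finitely many linear functionals. -/
theorem farkas {ι V : Type*} [AddCommGroup V] [Module ℝ V] (s : Finset ι) :
    ∀ (a : ι → V →ₗ[ℝ] ℝ) (b : V →ₗ[ℝ] ℝ), (∀ x, (∀ i ∈ s, 0 ≤ a i x) → 0 ≤ b x) →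
      ∃ w : ι → ℝ, (∀ i, 0 ≤ w i) ∧ b = ∑ i ∈ s, w i • a i := by
  classical
  induction s using Finset.induction_on with
  | empty =>
    intro a b h
    refine ⟨0, fun _ => le_rfl, ?_⟩
    ext x
    have h1 := h x (by simp)
    have h2 := h (-x) (by simp)
    rw [map_neg] at h2
    simp only [Finset.sum_empty, LinearMap.zero_apply]
    linarith
  | insert j s hj ih =>
    intro a b h
    -- If the constraint `j` is redundant it gets weight `0`. Otherwise some `x₀` violates only it,
    -- and `x₀` serves to eliminate `a j`.
    by_cases hs : ∀ x, (∀ i ∈ s, 0 ≤ a i x) → 0 ≤ b x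
    · obtain ⟨w, hw, hb⟩ := ih a b hs
      refine ⟨Function.update w j 0, fun i => ?_, ?_⟩
      · by_cases hi : i = j
        · subst hi; simp
        · simpa [hi] using hw i
      · rw [Finset.sum_insert hj, hb, Function.update_self, zero_smul, zero_add]
        refine Finset.sum_congr rfl fun i hi => ?_
        rw [Function.update_of_ne (ne_of_mem_of_not_mem hi hj)]
    · push Not at hs
      obtain ⟨x₀, hx₀, hbx₀⟩ := hs
      have hj₀ : a j x₀ < 0 := by
        by_contra hc
        push Not at hc
        refine absurd (h x₀ fun i hi => ?_) (not_le.2 hbx₀)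
        rcases Finset.mem_insert.1 hi with rfl | hi
        exacts [hc, hx₀ i hi]
      obtain ⟨x₁, hx₁, hbx₁, hj₁⟩ : ∃ x₁, (∀ i ∈ s, 0 ≤ a i x₁) ∧ b x₁ < 0 ∧ a j x₁ = -1 := by
        have hpos : 0 < (-(a j x₀))⁻¹ := inv_pos.2 (by linarith)
        refine ⟨(-(a j x₀))⁻¹ • x₀, fun i hi => ?_, ?_, ?_⟩
        · rw [map_smul, smul_eq_mul]; exact mul_nonneg hpos.le (hx₀ i hi)
        · rw [map_smul, smul_eq_mul]; exact mul_neg_of_pos_of_neg hpos hbx₀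
        · rw [map_smul, smul_eq_mul, inv_neg, neg_mul, inv_mul_cancel₀ hj₀.ne]
      -- These are `a i` and `b` composed with `x ↦ x + a j x • x₁`, the projection onto the kernel
      -- of `a j` along `x₁`; on its image the constraint `j` holds with equality.
      obtain ⟨w, hw, hb⟩ := ih (fun i => a i + a i x₁ • a j) (b + b x₁ • a j) fun x hx => by
        have := h (x + a j x • x₁) fun i hi => by
          rcases Finset.mem_insert.1 hi with rfl | hi
          · simp [hj₁]
          · have := hx i hi
            simp only [LinearMap.add_apply, LinearMap.smul_apply, smul_eq_mul, map_add,
              map_smul] at this ⊢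
            linarith
        simp only [LinearMap.add_apply, LinearMap.smul_apply, smul_eq_mul, map_add,
          map_smul] at this ⊢
        linarith
      have hnn : 0 ≤ ∑ i ∈ s, w i * a i x₁ - b x₁ := by
        have := Finset.sum_nonneg fun i hi => mul_nonneg (hw i) (hx₁ i hi)
        linarith
      refine ⟨Function.update w j (∑ i ∈ s, w i * a i x₁ - b x₁), fun i => ?_, ?_⟩
      · by_cases hi : i = j
        · subst hi; simpa using hnn
        · simpa [hi] using hw i
      · rw [Finset.sum_insert hj, Function.update_self,
          Finset.sum_congr rfl (g := fun i => w i • a i) fun i hi => by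
            rw [Function.update_of_ne (ne_of_mem_of_not_mem hi hj)]]
        ext x
        have := LinearMap.congr_fun hb x
        simp only [LinearMap.add_apply, LinearMap.smul_apply, smul_eq_mul, LinearMap.sum_apply,
          mul_add, Finset.sum_add_distrib] at this ⊢
        have e : ∑ i ∈ s, w i * (a i x₁ * a j x) = (∑ i ∈ s, w i * a i x₁) * a j x := by
          rw [Finset.sum_mul]; exact Finset.sum_congr rfl fun i _ => by ring
        rw [e] at this
        linarith

section LP

variable {m n : Type*} [Fintype m] [Fintype n] (M : Matrix m n ℝ) (r : m → ℝ) (c : n → ℝ)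

/-- Farkas' lemma on the cone of pairs `(y, t)`: the multipliers of the rows `M y - t r ≥ 0` form
`π`, and evaluating the identity at `(e_j, 0)` and `(0, 1)` gives the two inequalities. Homogenizing
avoids assuming feasibility, so the same statement yields strong duality and the infeasibility
certificate. -/
theorem exists_dual_of_homogeneous (v : ℝ)
    (h : ∀ (y : n → ℝ) (t : ℝ), 0 ≤ y → 0 ≤ t → t • r ≤ M *ᵥ y → v * t ≤ c ⬝ᵥ y) :
    ∃ π : m → ℝ, 0 ≤ π ∧ Mᵀ *ᵥ π ≤ c ∧ v ≤ r ⬝ᵥ π := by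
  classical
  let a : (n ⊕ m) ⊕ Unit → ((n → ℝ) × ℝ) →ₗ[ℝ] ℝ := Sum.elim (Sum.elim
    (fun j => LinearMap.proj j ∘ₗ LinearMap.fst ℝ _ _)
    (fun i => LinearMap.proj i ∘ₗ M.mulVecLin ∘ₗ LinearMap.fst ℝ _ _
      - r i • LinearMap.snd ℝ _ _)) (fun _ => LinearMap.snd ℝ _ _)
  let b : ((n → ℝ) × ℝ) →ₗ[ℝ] ℝ := dotProductBilin ℝ ℝ c ∘ₗ LinearMap.fst ℝ _ _
    - v • LinearMap.snd ℝ _ _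
  obtain ⟨w, hw, hb⟩ := farkas Finset.univ a b (by
    rintro ⟨y, t⟩ hx
    have h1 : ∀ j, 0 ≤ y j := fun j => hx (.inl (.inl j)) (Finset.mem_univ _)
    have h2 : ∀ i, 0 ≤ (M *ᵥ y) i - r i * t := fun i => hx (.inl (.inr i)) (Finset.mem_univ _)
    have h3 : 0 ≤ t := hx (.inr ()) (Finset.mem_univ _)
    have := h y t h1 h3 fun i => by
      have := h2 i
      simp only [Pi.smul_apply, smul_eq_mul]; linarith
    change 0 ≤ c ⬝ᵥ y - v * t
    linarith)
  have key : ∀ (y : n → ℝ) (t : ℝ), c ⬝ᵥ y - v * t = ∑ j, w (.inl (.inl j)) * y j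
      + ∑ i, w (.inl (.inr i)) * ((M *ᵥ y) i - r i * t) + w (.inr ()) * t := fun y t => by
    have := LinearMap.congr_fun hb (y, t)
    simp only [Fintype.sum_sum_type] at this
    simpa [a, b] using this
  refine ⟨fun i => w (.inl (.inr i)), fun i => hw _, fun j => ?_, ?_⟩
  · have := key (Pi.single j 1) 0
    simp only [dotProduct_single, mul_one, mul_zero, sub_zero, Matrix.mulVec_single_one, add_zero,
      Pi.single_apply, mul_ite, Finset.sum_ite_eq', Finset.mem_univ, if_true, Matrix.col_apply]
      at this
    have h0 := hw (.inl (.inl j))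
    rw [this]
    simp only [Matrix.mulVec, dotProduct, Matrix.transpose_apply]
    rw [Finset.sum_congr rfl fun i _ => mul_comm (M i j) _]
    linarith
  · have := key 0 1
    simp only [dotProduct_zero, mul_one, Pi.zero_apply, mul_zero, Matrix.mulVec_zero, zero_sub,
      Finset.sum_const_zero, zero_add] at this
    have h0 := hw (.inr ())
    simp only [dotProduct]
    simp only [mul_neg, Finset.sum_neg_distrib] at this
    rw [Finset.sum_congr rfl fun i _ => mul_comm (r i) _]
    linarith

/-- Weak duality. -/
theorem weak_duality {y : n → ℝ} {π : m → ℝ} (hy : 0 ≤ y) (hMy : r ≤ M *ᵥ y) (hπ : 0 ≤ π)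
    (hMπ : Mᵀ *ᵥ π ≤ c) : r ⬝ᵥ π ≤ c ⬝ᵥ y :=
  calc r ⬝ᵥ π ≤ (M *ᵥ y) ⬝ᵥ π := dotProduct_le_dotProduct_of_nonneg_right hMy hπ
    _ = (Mᵀ *ᵥ π) ⬝ᵥ y := by
      rw [Matrix.mulVec_transpose, ← Matrix.dotProduct_mulVec, dotProduct_comm]
    _ ≤ c ⬝ᵥ y := dotProduct_le_dotProduct_of_nonneg_right hMπ hy

/-- Strong duality: a lower bound for a feasible linear program is certified by the dual. -/
theorem exists_dual_of_forall_le {y₀ : n → ℝ} (hy₀ : 0 ≤ y₀) (hMy₀ : r ≤ M *ᵥ y₀) (v : ℝ)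
    (h : ∀ y : n → ℝ, 0 ≤ y → r ≤ M *ᵥ y → v ≤ c ⬝ᵥ y) :
    ∃ π : m → ℝ, 0 ≤ π ∧ Mᵀ *ᵥ π ≤ c ∧ v ≤ r ⬝ᵥ π := by
  refine exists_dual_of_homogeneous M r c v fun y t hy ht hMy => ?_
  -- For `t = 0`, `y` is a recession direction; if it had negative cost, `y₀ + k y` would violate
  -- the bound `v` for large `k`. For `t > 0`, rescale.
  rcases ht.eq_or_lt with rfl | ht
  · by_contra! hc
    rw [mul_zero] at hc
    rw [zero_smul] at hMy
    obtain ⟨k, hk⟩ := exists_nat_gt ((c ⬝ᵥ y₀ - v) / -(c ⬝ᵥ y))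
    rw [div_lt_iff₀ (by linarith)] at hk
    have := h (y₀ + (k : ℝ) • y) (add_nonneg hy₀ (smul_nonneg k.cast_nonneg hy)) (by
      rw [Matrix.mulVec_add, Matrix.mulVec_smul]
      exact le_add_of_le_of_nonneg hMy₀ (smul_nonneg k.cast_nonneg hMy))
    rw [dotProduct_add, dotProduct_smul, smul_eq_mul] at this
    linarith
  · have := h (t⁻¹ • y) (smul_nonneg (inv_nonneg.2 ht.le) hy) (by
      rw [Matrix.mulVec_smul]
      calc r = t⁻¹ • t • r := by rw [smul_smul, inv_mul_cancel₀ ht.ne', one_smul]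
        _ ≤ _ := smul_le_smul_of_nonneg_left hMy (inv_nonneg.2 ht.le))
    rw [dotProduct_smul, smul_eq_mul, ← div_eq_inv_mul, le_div_iff₀ ht] at this
    exact this

/-- An infeasible linear program has an improving direction of the dual. -/
theorem exists_ray_of_infeasible (h : ∀ y : n → ℝ, 0 ≤ y → ¬ r ≤ M *ᵥ y) :
    ∃ γ : m → ℝ, 0 ≤ γ ∧ Mᵀ *ᵥ γ ≤ 0 ∧ 0 < r ⬝ᵥ γ := by
  -- With cost `0` and `v = 1` the hypothesis says `t ≤ 0`: a point with `t > 0` would rescale to a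
  -- feasible one.
  obtain ⟨γ, h1, h2, h3⟩ := exists_dual_of_homogeneous M r 0 1 fun y t hy ht hMy => by
    rcases ht.eq_or_lt with rfl | ht
    · simp
    · refine absurd ?_ (h (t⁻¹ • y) (smul_nonneg (inv_nonneg.2 ht.le) hy))
      rw [Matrix.mulVec_smul]
      calc r = t⁻¹ • t • r := by rw [smul_smul, inv_mul_cancel₀ ht.ne', one_smul]
        _ ≤ _ := smul_le_smul_of_nonneg_left hMy (inv_nonneg.2 ht.le)
  exact ⟨γ, h1, h2, one_pos.trans_le h3⟩

end LP

/-! ### Counting points by their tight constraints -/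

/-- Points at which the tight constraints have rank `k`, and which are determined by any subsystem
of tight constraints of that rank, are at most as many as the `k`-subsets of the constraints. -/
theorem finite_and_ncard_le_choose {ι V : Type*} [Fintype ι] [AddCommGroup V] [Module ℝ V]
    [FiniteDimensional ℝ V] (a : ι → V →ₗ[ℝ] ℝ) (b : ι → ℝ) (S : Set V) (k : ℕ)
    (hk : ∀ x ∈ S, Module.finrank ℝ (Submodule.span ℝ (a '' {i | a i x = b i})) = k)
    (hS : ∀ x ∈ S, ∀ y ∈ S, (∀ i, a i x = b i → a i (y - x) = 0) → y = x) :
    S.Finite ∧ S.ncard ≤ (Fintype.card ι).choose k := by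
  classical
  have hJ : ∀ x ∈ S, ∃ J : Finset ι, J.card = k ∧ (∀ i ∈ J, a i x = b i) ∧
      ∀ i, a i x = b i → a i ∈ Submodule.span ℝ (a '' (J : Set ι)) := fun x hx => by
    -- `J` indexes a basis of the span of the tight functionals, chosen among the tight constraints
    -- themselves.
    obtain ⟨J, hJs, -, hspan, hJi⟩ := exists_linearIndepOn_extension (K := ℝ) (v := a)
      (s := ∅) (t := {i | a i x = b i}) (linearIndepOn_empty ℝ a) (Set.empty_subset _)
    refine ⟨J.toFinset, ?_, fun i hi => hJs (Set.mem_toFinset.1 hi), fun i hi => ?_⟩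
    · rw [← hk x hx, Set.toFinset_card]
      have he : Submodule.span ℝ (a '' {i | a i x = b i}) = Submodule.span ℝ (a '' J) :=
        le_antisymm (Submodule.span_le.2 hspan) (Submodule.span_mono (Set.image_mono hJs))
      rw [he, Set.image_eq_range, finrank_span_eq_card hJi.linearIndependent]
    · rw [Set.coe_toFinset]
      exact hspan ⟨i, hi, rfl⟩
  choose! J hcard htight hspan using hJ
  have hmaps : Set.MapsTo J S (Finset.powersetCard k (Finset.univ : Finset ι)) := fun x hx => by
    simp [hcard x hx]
  have hinj : Set.InjOn J S := fun x hx y hy hxy => by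
    refine (hS x hx y hy fun i hi => ?_).symm
    -- With a common `J`, its rows are tight at both points and vanish on `y - x`; hence so does
    -- every row tight at `x`.
    have hle : Submodule.span ℝ (a '' (J x : Set ι)) ≤
        LinearMap.ker (Module.Dual.eval ℝ V (y - x)) := by
      rw [Submodule.span_le]
      rintro _ ⟨j, hj, rfl⟩
      have h1 := htight x hx j hj
      have h2 := htight y hy j (hxy ▸ hj)
      simp [h1, h2]
    simpa using hle (hspan x hx i hi)
  refine ⟨Set.Finite.of_injOn hmaps hinj (Finset.finite_toSet _), ?_⟩
  have := Set.ncard_le_ncard_of_injOn J hmaps hinj (Finset.finite_toSet _)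
  rwa [Set.ncard_coe_finset, Finset.card_powersetCard, Finset.card_univ] at this

/-- Slack constraints stay satisfied under small perturbations along the tight ones. -/
theorem exists_perturbation {ι V : Type*} [Finite ι] [AddCommGroup V] [Module ℝ V]
    (a : ι → V →ₗ[ℝ] ℝ) (b : ι → ℝ) {x w : V} (hx : ∀ i, a i x ≤ b i)
    (hw : ∀ i, a i x = b i → a i w = 0) :
    ∃ ε : ℝ, 0 < ε ∧ (∀ i, a i (x + ε • w) ≤ b i) ∧ ∀ i, a i (x - ε • w) ≤ b i := by
  have : ∀ᶠ ε : ℝ in nhdsWithin 0 (Set.Ioi 0), ∀ i, a i x + ε * |a i w| ≤ b i := by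
    refine Filter.eventually_all.2 fun i => ?_
    rcases (hx i).eq_or_lt with h | h
    · simp [hw i h, h]
    · have hc : Filter.Tendsto (fun ε : ℝ => a i x + ε * |a i w|) (nhds 0)
          (nhds (a i x + 0 * |a i w|)) := Continuous.tendsto (by fun_prop) 0
      rw [zero_mul, add_zero] at hc
      exact ((hc.eventually (eventually_lt_nhds h)).filter_mono nhdsWithin_le_nhds).mono
        fun _ => le_of_lt
  obtain ⟨ε, h, hε⟩ := (this.and self_mem_nhdsWithin).exists
  have hε : 0 < ε := hε
  refine ⟨ε, hε, fun i => ?_, fun i => ?_⟩ <;>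
  · simp only [map_add, map_sub, map_smul, smul_eq_mul]
    have h1 := h i
    have h2 := mul_le_mul_of_nonneg_left (le_abs_self (a i w)) hε.le
    have h3 := mul_le_mul_of_nonneg_left (neg_le_abs (a i w)) hε.le
    linarith

/-- The common kernel of functionals and their span have complementary dimensions. -/
theorem finrank_span_add_finrank_kernel {ι V : Type*} [AddCommGroup V] [Module ℝ V]
    [FiniteDimensional ℝ V] (a : ι → V →ₗ[ℝ] ℝ) (T : Set ι) (K : Submodule ℝ V)
    (hK : ∀ w, w ∈ K ↔ ∀ i ∈ T, a i w = 0) :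
    Module.finrank ℝ (Submodule.span ℝ (a '' T)) + Module.finrank ℝ K = Module.finrank ℝ V := by
  have : K = (Submodule.span ℝ (a '' T)).dualCoannihilator := by
    ext w
    rw [hK, Submodule.mem_dualCoannihilator]
    refine ⟨fun h φ hφ => ?_, fun h i hi => h _ (Submodule.subset_span ⟨i, hi, rfl⟩)⟩
    have hle : Submodule.span ℝ (a '' T) ≤ LinearMap.ker (Module.Dual.eval ℝ V w) := by
      rw [Submodule.span_le]
      rintro _ ⟨j, hj, rfl⟩
      simpa using h j hj
    simpa using hle hφ
  rw [this]
  exact Subspace.finrank_add_finrank_dualCoannihilator_eq _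

/-! ### Vertices and extreme rays of the dual polyhedron -/

namespace Problem

variable {mx nx kx nu μu ny μy : ℕ} (p : Problem mx nx kx nu μu ny μy)

/-- Left-hand sides of the constraints of the dual polyhedron. -/
noncomputable def dualRow : Fin ny ⊕ Fin μy → (Fin μy → ℝ) →ₗ[ℝ] ℝ :=
  Sum.elim (fun j => LinearMap.proj j ∘ₗ p.B₂ᵀ.mulVecLin) (fun i => -LinearMap.proj i)

theorem mem_dualSet_iff {π : Fin μy → ℝ} :
    π ∈ p.dualSet ↔ ∀ i, p.dualRow i π ≤ Sum.elim p.c₂ 0 i := by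
  simp [dualSet, dualRow, Sum.forall, Pi.le_def, and_comm, Matrix.mulVec_transpose]

theorem mem_recCone_iff {γ : Fin μy → ℝ} :
    γ ∈ p.recCone ↔ ∀ i, p.dualRow i γ ≤ 0 := by
  simp [recCone, dualRow, Sum.forall, Pi.le_def, and_comm, Matrix.mulVec_transpose]

/-- A vector `w` annihilated by the tight rows at an extreme point `x` makes `x` the midpoint of `x
± ε w` in `Π`, so `w = 0`. The tight rows thus have full rank `μy`. -/
theorem extPts_finite_and_ncard_le :
    p.extPts.Finite ∧ p.extPts.ncard ≤ (ny + μy).choose μy := by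
  have hK : ∀ x ∈ p.extPts, ∀ w, (∀ i, p.dualRow i x = Sum.elim p.c₂ 0 i → p.dualRow i w = 0) →
      w = 0 := fun x hx w hw => by
    obtain ⟨ε, hε, h1, h2⟩ := exists_perturbation _ _ (p.mem_dualSet_iff.1 hx.1) hw
    have := (mem_extremePoints.1 hx).2 _ (p.mem_dualSet_iff.2 h1) _ (p.mem_dualSet_iff.2 h2)
      ⟨1 / 2, 1 / 2, by norm_num, by norm_num, by norm_num, by
        rw [← smul_add, add_add_sub_cancel, ← two_smul ℝ x, smul_smul]; norm_num⟩
    have h3 : ε • w = 0 := by simpa using this.1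
    exact (smul_eq_zero.1 h3).resolve_left hε.ne'
  have := finite_and_ncard_le_choose p.dualRow (Sum.elim p.c₂ 0) p.extPts μy
    (fun x hx => by
      have := finrank_span_add_finrank_kernel p.dualRow {i | p.dualRow i x = Sum.elim p.c₂ 0 i} ⊥
        fun w => ⟨fun h i _ => by rw [(Submodule.mem_bot ℝ).1 h, map_zero],
          fun h => (Submodule.mem_bot ℝ).2 (hK x hx w h)⟩
      simpa using this)
    (fun x hx y _ h => sub_eq_zero.1 (hK x hx _ h))
  simpa using this

/-- Perturbing inside the cone shows that the tight rows at an extreme ray have common kernel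
exactly `ℝ γ`, hence rank `μy - 1`; the normalization picks one vector on that line. The count `(ny
+ μy).choose (μy - 1)` is then rewritten with `μy` in the lower index. -/
theorem extRays_finite_and_ncard_le :
    p.extRays.Finite ∧ (p.extRays.ncard : ℝ) ≤ μy / (ny + 1) * ((ny + μy).choose μy : ℝ) := by
  have hK : ∀ γ ∈ p.extRays, ∀ w, (∀ i, p.dualRow i γ = 0 → p.dualRow i w = 0) →
      ∃ s : ℝ, w = s • γ := fun γ hγ w hw => by
    obtain ⟨ε, hε, h1, h2⟩ := exists_perturbation _ 0 (p.mem_recCone_iff.1 hγ.1.1) hw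
    have hhalf : ∀ γ ∈ p.recCone, (1 / 2 : ℝ) • γ ∈ p.recCone := fun γ h => by
      rw [mem_recCone_iff] at h ⊢
      intro i
      rw [map_smul, smul_eq_mul]
      linarith [h i]
    obtain ⟨s, hs⟩ := hγ.1.2.2 _ (hhalf _ (p.mem_recCone_iff.2 h1)) _
      (hhalf _ (p.mem_recCone_iff.2 h2)) (by
        rw [← smul_add, add_add_sub_cancel, ← two_smul ℝ γ, smul_smul]; norm_num)
    -- Solves `(1/2) (γ + ε w) = s γ` for `w`.
    refine ⟨(2 * s - 1) / ε, ?_⟩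
    ext i
    have := congrFun hs i
    simp only [Pi.smul_apply, Pi.add_apply, smul_eq_mul] at this ⊢
    field_simp
    linarith
  have hcard := finite_and_ncard_le_choose p.dualRow 0 p.extRays (μy - 1)
    (fun γ hγ => by
      have := finrank_span_add_finrank_kernel p.dualRow {i | p.dualRow i γ = 0}
        (Submodule.span ℝ {γ}) fun w => ⟨fun h i (hi : _ = _) => by
          obtain ⟨s, rfl⟩ := Submodule.mem_span_singleton.1 h
          rw [map_smul, hi, smul_zero], fun h => by
          obtain ⟨s, rfl⟩ := hK γ hγ w h
          exact Submodule.smul_mem _ _ (Submodule.mem_span_singleton_self γ)⟩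
      rw [finrank_span_singleton hγ.1.2.1, Module.finrank_fin_fun] at this
      exact Nat.eq_sub_of_add_eq this)
    (fun x hx y hy h => by
      obtain ⟨s, hs⟩ := hK x hx _ h
      have : ∑ i, (y - x) i = s * ∑ i, x i := by
        rw [hs, Finset.mul_sum]; rfl
      simp only [Pi.sub_apply, Finset.sum_sub_distrib, hx.2, hy.2, sub_self, mul_one] at this
      rw [← this, zero_smul] at hs
      exact sub_eq_zero.1 hs)
  refine ⟨hcard.1, ?_⟩
  -- For `μy = 0` the truncated `μy - 1` would count one ray while the claimed bound is `0`; but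
  -- there is no nonzero direction then.
  obtain _ | m := μy
  · have : p.extRays = ∅ := Set.eq_empty_of_forall_notMem fun γ hγ =>
      hγ.1.2.1 (Subsingleton.elim _ _)
    simp [this]
  · have h2 : (p.extRays.ncard : ℝ) ≤ ((ny + (m + 1)).choose m : ℝ) := by
      exact_mod_cast (by simpa using hcard.2)
    refine h2.trans (le_of_eq ?_)
    have := Nat.choose_succ_right_eq (ny + (m + 1)) m
    rw [show ny + (m + 1) - m = ny + 1 by omega] at this
    have h3 : ((ny + (m + 1)).choose (m + 1) : ℝ) * (m + 1) =
      (ny + (m + 1)).choose m * (ny + 1) := by exact_mod_cast this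
    rw [div_mul_eq_mul_div, eq_div_iff (by positivity), ← h3]
    push_cast
    ring

/-! ### Extreme points and extreme rays selected by a linear functional -/

theorem isClosed_dualSet : IsClosed p.dualSet :=
  (isClosed_le continuous_const continuous_id).inter
    (isClosed_le (Continuous.matrix_mulVec continuous_const continuous_id) continuous_const)

theorem isClosed_recCone : IsClosed p.recCone :=
  (isClosed_le continuous_const continuous_id).inter
    (isClosed_le (Continuous.matrix_mulVec continuous_const continuous_id) continuous_const)

/-- Closed sets of non-negative vectors with bounded coordinate sum are compact. -/
theorem _root_.RobustDDU.isCompact_of_sum_le {m : Type*} [Fintype m] {S : Set (m → ℝ)}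
    (hS : IsClosed S) (C : ℝ) (h : ∀ π ∈ S, 0 ≤ π ∧ ∑ i, π i ≤ C) : IsCompact S :=
  (isCompact_Icc (a := (0 : m → ℝ)) (b := fun _ => C)).of_isClosed_subset hS fun π hπ =>
    ⟨(h π hπ).1, fun i => (Finset.single_le_sum (fun j _ => (h π hπ).1 j)
      (Finset.mem_univ i)).trans (h π hπ).2⟩

/-- A maximum of a linear functional over a polyhedron of non-negative vectors is attained at an
extreme point. -/
theorem exists_extPts_eq (r : Fin μy → ℝ) {π₀ : Fin μy → ℝ} (hπ₀ : π₀ ∈ p.dualSet)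
    (hmax : ∀ π ∈ p.dualSet, r ⬝ᵥ π ≤ r ⬝ᵥ π₀) : ∃ π ∈ p.extPts, r ⬝ᵥ π = r ⬝ᵥ π₀ := by
  have hsum : Continuous fun π : Fin μy → ℝ => ∑ i, π i := by fun_prop
  have hr : Continuous fun π : Fin μy → ℝ => r ⬝ᵥ π := by unfold dotProduct; fun_prop
  -- The optimal face may be unbounded. Minimizing the coordinate sum on it as a second objective
  -- gives a compact set that is still extreme in `Π`, so its extreme points are extreme points of
  -- `Π`.
  have hK : IsCompact {π | π ∈ p.dualSet ∧ r ⬝ᵥ π = r ⬝ᵥ π₀ ∧ ∑ i, π i ≤ ∑ i, π₀ i} :=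
    isCompact_of_sum_le (p.isClosed_dualSet.inter ((isClosed_eq hr continuous_const).inter
      (isClosed_le hsum continuous_const))) _ fun π h => ⟨h.1.1, h.2.2⟩
  obtain ⟨π₁, hπ₁, hmin⟩ := hK.exists_isMinOn ⟨π₀, hπ₀, rfl, le_rfl⟩ hsum.continuousOn
  have hG : IsCompact ({π | π ∈ p.dualSet ∧ r ⬝ᵥ π = r ⬝ᵥ π₀ ∧ ∑ i, π i ≤ ∑ i, π₀ i} ∩
      {π | ∑ i, π i = ∑ i, π₁ i}) := hK.inter_right (isClosed_eq hsum continuous_const)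
  obtain ⟨e, he⟩ := hG.extremePoints_nonempty ⟨π₁, hπ₁, rfl⟩
  refine ⟨e, IsExtreme.extremePoints_subset_extremePoints ⟨fun π h => h.1.1, ?_⟩ he,
    he.1.1.2.1⟩
  rintro α hα β hβ π ⟨⟨hπ, hrπ, -⟩, (hsπ : _ = _)⟩ ⟨s, t, hs, ht, hst, rfl⟩
  have e1 : s * (r ⬝ᵥ α) + t * (r ⬝ᵥ β) = r ⬝ᵥ π₀ := by
    rw [← hrπ, dotProduct_add, dotProduct_smul, dotProduct_smul]; rfl
  have e2 : s * ∑ i, α i + t * ∑ i, β i = ∑ i, π₁ i := by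
    rw [← hsπ, Finset.mul_sum, Finset.mul_sum, ← Finset.sum_add_distrib]; rfl
  have a1 := hmax α hα
  have b1 := hmax β hβ
  have a2 : r ⬝ᵥ α = r ⬝ᵥ π₀ := by
    by_contra hne
    have := mul_lt_mul_of_pos_left (lt_of_le_of_ne a1 hne) hs
    have := mul_le_mul_of_nonneg_left b1 ht.le
    have : (s + t) * (r ⬝ᵥ π₀) = r ⬝ᵥ π₀ := by rw [hst, one_mul]
    linarith
  have b2 : r ⬝ᵥ β = r ⬝ᵥ π₀ := by
    rw [a2] at e1
    have : t * (r ⬝ᵥ β) = t * (r ⬝ᵥ π₀) := by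
      have : (s + t) * (r ⬝ᵥ π₀) = r ⬝ᵥ π₀ := by rw [hst, one_mul]
      linarith
    exact mul_left_cancel₀ ht.ne' this
  -- The truncation does not affect the minimum: an optimal point outside it has a sum of at least
  -- that of `π₀`.
  have hm : ∀ δ ∈ p.dualSet, r ⬝ᵥ δ = r ⬝ᵥ π₀ → ∑ i, π₁ i ≤ ∑ i, δ i := fun δ h1 h2 => by
    rcases le_total (∑ i, δ i) (∑ i, π₀ i) with h | h
    · exact hmin ⟨h1, h2, h⟩
    · exact hπ₁.2.2.trans h
  have a3 := hm α hα a2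
  have b3 := hm β hβ b2
  have a4 : ∑ i, α i = ∑ i, π₁ i := by
    by_contra hne
    have := mul_lt_mul_of_pos_left (lt_of_le_of_ne a3 (Ne.symm hne)) hs
    have := mul_le_mul_of_nonneg_left b3 ht.le
    have : (s + t) * (∑ i, π₁ i) = ∑ i, π₁ i := by rw [hst, one_mul]
    linarith
  exact ⟨⟨hα, a2, a4.le.trans hπ₁.2.2⟩, a4⟩

/-- A linear functional that is positive somewhere on the recession cone is positive on an extreme
ray. -/
theorem exists_extRays_pos (r : Fin μy → ℝ) {γ₀ : Fin μy → ℝ} (hγ₀ : γ₀ ∈ p.recCone)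
    (hpos : 0 < r ⬝ᵥ γ₀) : ∃ γ ∈ p.extRays, 0 < r ⬝ᵥ γ := by
  have hsum : Continuous fun π : Fin μy → ℝ => ∑ i, π i := by fun_prop
  have hr : Continuous fun π : Fin μy → ℝ => r ⬝ᵥ π := by unfold dotProduct; fun_prop
  have hcone : ∀ γ ∈ p.recCone, ∀ s : ℝ, 0 ≤ s → s • γ ∈ p.recCone := fun γ h s hs => by
    rw [mem_recCone_iff] at h ⊢
    intro i
    rw [map_smul, smul_eq_mul]
    exact mul_nonpos_of_nonneg_of_nonpos hs (h i)
  have hsmul : ∀ (γ : Fin μy → ℝ) (s : ℝ), ∑ i, (s • γ) i = s * ∑ i, γ i := fun γ s => by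
    rw [Finset.mul_sum]; rfl
  have hzero : ∀ γ ∈ p.recCone, ∑ i, γ i = 0 → γ = 0 := fun γ h h0 => by
    ext i
    exact (Finset.sum_eq_zero_iff_of_nonneg fun j _ => h.1 j).1 h0 i (Finset.mem_univ i)
  -- This slice is a compact base of the cone; a maximizer of `r` on it that is an extreme point of
  -- the base generates the ray sought.
  have hK : IsCompact {γ | γ ∈ p.recCone ∧ ∑ i, γ i = 1} :=
    isCompact_of_sum_le (p.isClosed_recCone.inter (isClosed_eq hsum continuous_const)) 1
      fun π h => ⟨h.1.1, h.2.le⟩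
  have hσ : 0 < ∑ i, γ₀ i := by
    refine lt_of_le_of_ne (Finset.sum_nonneg fun i _ => hγ₀.1 i) fun h => ?_
    rw [hzero γ₀ hγ₀ h.symm, dotProduct_zero] at hpos
    exact lt_irrefl _ hpos
  have hnorm : (∑ i, γ₀ i)⁻¹ • γ₀ ∈ {γ | γ ∈ p.recCone ∧ ∑ i, γ i = 1} :=
    ⟨hcone _ hγ₀ _ (inv_nonneg.2 hσ.le), by rw [hsmul, inv_mul_cancel₀ hσ.ne']⟩
  obtain ⟨γ₁, hγ₁, hmax⟩ := hK.exists_isMaxOn ⟨_, hnorm⟩ hr.continuousOn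
  have hpos₁ : 0 < r ⬝ᵥ γ₁ := by
    refine lt_of_lt_of_le ?_ (hmax hnorm)
    change 0 < r ⬝ᵥ ((∑ i, γ₀ i)⁻¹ • γ₀)
    rw [dotProduct_smul, smul_eq_mul]
    exact mul_pos (inv_pos.2 hσ) hpos
  obtain ⟨e, he⟩ := (hK.inter_right (isClosed_eq hr continuous_const)).extremePoints_nonempty
    ⟨γ₁, hγ₁, (rfl : r ⬝ᵥ γ₁ = r ⬝ᵥ γ₁)⟩
  have he' : e ∈ Set.extremePoints ℝ {γ | γ ∈ p.recCone ∧ ∑ i, γ i = 1} := by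
    refine IsExtreme.extremePoints_subset_extremePoints ⟨fun π h => h.1, ?_⟩ he
    rintro α hα β hβ π ⟨hπ, (hrπ : _ = _)⟩ ⟨s, t, hs, ht, hst, rfl⟩
    refine ⟨hα, ?_⟩
    have e1 : s * (r ⬝ᵥ α) + t * (r ⬝ᵥ β) = r ⬝ᵥ γ₁ := by
      rw [← hrπ, dotProduct_add, dotProduct_smul, dotProduct_smul]; rfl
    have a1 : r ⬝ᵥ α ≤ r ⬝ᵥ γ₁ := hmax hα
    have b1 : r ⬝ᵥ β ≤ r ⬝ᵥ γ₁ := hmax hβ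
    by_contra hne
    have := mul_lt_mul_of_pos_left (lt_of_le_of_ne a1 hne) hs
    have := mul_le_mul_of_nonneg_left b1 ht.le
    have : (s + t) * (r ⬝ᵥ γ₁) = r ⬝ᵥ γ₁ := by rw [hst, one_mul]
    linarith
  refine ⟨e, ⟨⟨he'.1.1, ?_, ?_⟩, he'.1.2⟩, ?_⟩
  · rintro rfl
    simpa using he'.1.2
  · intro α hα β hβ hαβ
    have hs : ∑ i, α i + ∑ i, β i = 1 := by
      rw [← he'.1.2, ← hαβ, ← Finset.sum_add_distrib]; rfl
    rcases (Finset.sum_nonneg fun i _ => hα.1 i : 0 ≤ ∑ i, α i).eq_or_lt with h0 | h0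
    · exact ⟨0, by rw [zero_smul]; exact hzero α hα h0.symm⟩
    rcases (Finset.sum_nonneg fun i _ => hβ.1 i : 0 ≤ ∑ i, β i).eq_or_lt with h1 | h1
    · refine ⟨1, ?_⟩
      rw [one_smul, ← hαβ, hzero β hβ h1.symm, add_zero]
    -- The sums of `α` and `β` add to `1`, so `e` is a convex combination of their normalizations;
    -- extremality in the base identifies `e` with the normalized `α`.
    · refine ⟨∑ i, α i, ?_⟩
      have := ((mem_extremePoints.1 he').2 ((∑ i, α i)⁻¹ • α)
        ⟨hcone _ hα _ (inv_nonneg.2 h0.le), by rw [hsmul, inv_mul_cancel₀ h0.ne']⟩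
        ((∑ i, β i)⁻¹ • β)
        ⟨hcone _ hβ _ (inv_nonneg.2 h1.le), by rw [hsmul, inv_mul_cancel₀ h1.ne']⟩
        ⟨_, _, h0, h1, hs, by
          rw [smul_smul, smul_smul, mul_inv_cancel₀ h0.ne', mul_inv_cancel₀ h1.ne', one_smul,
            one_smul, hαβ]⟩).1
      rw [← this, smul_smul, mul_inv_cancel₀ h0.ne', one_smul]
  · have : r ⬝ᵥ e = r ⬝ᵥ γ₁ := he.1.2
    rwa [this]

/-! ### Scenarios satisfying the KKT conditions -/

theorem rhs_dotProduct (x : Fin mx ⊕ Fin nx → ℝ) (u : Fin nu → ℝ) (β : Fin μy → ℝ) :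
    p.rhs x u ⬝ᵥ β = (p.d - p.B₁ *ᵥ x) ⬝ᵥ β - (p.Eᵀ *ᵥ β) ⬝ᵥ u := by
  rw [rhs, sub_dotProduct _ (p.E *ᵥ u), Matrix.mulVec_transpose, ← Matrix.dotProduct_mulVec,
    dotProduct_comm β]

theorem continuous_rhs_dotProduct (x : Fin mx ⊕ Fin nx → ℝ) :
    Continuous fun q : (Fin nu → ℝ) × (Fin μy → ℝ) => p.rhs x q.1 ⬝ᵥ q.2 := by
  unfold rhs
  exact (continuous_const.sub (Continuous.matrix_mulVec continuous_const
    continuous_fst)).dotProduct continuous_snd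

variable {p}

theorem isCompact_U (hA2 : p.A2) {x : Fin mx ⊕ Fin nx → ℝ} (hx : x ∈ p.X) :
    IsCompact (p.U x) :=
  Metric.isCompact_of_isClosed_isBounded
    ((isClosed_le continuous_const continuous_id).inter
      (isClosed_le (Continuous.matrix_mulVec continuous_const continuous_id) continuous_const))
    (hA2 x hx)

theorem kkt_mem_U {x : Fin mx ⊕ Fin nx → ℝ} {β : Fin μy → ℝ}
    {q : (Fin nu → ℝ) × (Fin μu → ℝ)} (hq : q ∈ p.kkt x β) : q.1 ∈ p.U x :=
  ⟨hq.2.2.2.2.1, hq.1⟩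

/-- The KKT conditions are sufficient for optimality. -/
theorem rhs_dotProduct_le_of_kkt {x : Fin mx ⊕ Fin nx → ℝ} {β : Fin μy → ℝ}
    {q : (Fin nu → ℝ) × (Fin μu → ℝ)} (hq : q ∈ p.kkt x β) {u : Fin nu → ℝ} (hu : u ∈ p.U x) :
    p.rhs x u ⬝ᵥ β ≤ p.rhs x q.1 ⬝ᵥ β := by
  obtain ⟨hF, hd, hc1, hc2, h1, h2⟩ := hq
  have hw := weak_duality (p.F x)ᵀ (-(p.Eᵀ *ᵥ β)) (p.h + p.G *ᵥ x) h2 hd hu.1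
    (by rw [Matrix.transpose_transpose]; exact hu.2)
  -- Complementarity, summed over coordinates, closes the duality gap: the multiplier's dual
  -- objective equals the primal objective at `q.1`.
  have e1 : q.2 ⬝ᵥ (p.h + p.G *ᵥ x - p.F x *ᵥ q.1) = 0 := by
    have := congrArg (fun f => ∑ i, f i) hc1
    simpa [dotProduct] using this
  have e2 : q.1 ⬝ᵥ ((p.F x)ᵀ *ᵥ q.2 + p.Eᵀ *ᵥ β) = 0 := by
    have := congrArg (fun f => ∑ i, f i) hc2
    simpa [dotProduct] using this
  rw [dotProduct_sub, Matrix.dotProduct_mulVec] at e1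
  rw [dotProduct_add, Matrix.mulVec_transpose, dotProduct_comm] at e2
  rw [rhs_dotProduct, rhs_dotProduct]
  rw [neg_dotProduct, dotProduct_comm _ q.2] at hw
  rw [dotProduct_comm q.1] at e2
  linarith

/-- Compactness provides an optimal scenario and strong duality a multiplier. The complementarity
products are nonnegative with total at most `0`, so each of them vanishes. -/
theorem kkt_nonempty (hA1 : p.A1) (hA2 : p.A2) {x : Fin mx ⊕ Fin nx → ℝ} (hx : x ∈ p.X)
    (β : Fin μy → ℝ) : (p.kkt x β).Nonempty := by
  have hcont : Continuous fun u : Fin nu → ℝ => (p.Eᵀ *ᵥ β) ⬝ᵥ u :=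
    continuous_const.dotProduct continuous_id
  obtain ⟨u, hu, hmin⟩ := (isCompact_U hA2 hx).exists_isMinOn (hA1 x hx) hcont.continuousOn
  obtain ⟨l, hl, hd, hv⟩ := exists_dual_of_forall_le (-p.F x) (-(p.h + p.G *ᵥ x)) (p.Eᵀ *ᵥ β)
    hu.1 (by rw [Matrix.neg_mulVec]; exact neg_le_neg hu.2) ((p.Eᵀ *ᵥ β) ⬝ᵥ u) fun u' h0 h1 =>
      hmin ⟨h0, by rw [Matrix.neg_mulVec] at h1; exact neg_le_neg_iff.1 h1⟩
  rw [Matrix.transpose_neg, Matrix.neg_mulVec] at hd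
  have hd' : 0 ≤ (p.F x)ᵀ *ᵥ l + p.Eᵀ *ᵥ β := neg_le_iff_add_nonneg'.1 hd
  have hslack : 0 ≤ p.h + p.G *ᵥ x - p.F x *ᵥ u := sub_nonneg.2 hu.2
  have n1 : ∀ i, 0 ≤ (l * (p.h + p.G *ᵥ x - p.F x *ᵥ u)) i := fun i =>
    mul_nonneg (hl i) (hslack i)
  have n2 : ∀ j, 0 ≤ (u * ((p.F x)ᵀ *ᵥ l + p.Eᵀ *ᵥ β)) j := fun j =>
    mul_nonneg (hu.1 j) (hd' j)
  have hsum : ∑ i, (l * (p.h + p.G *ᵥ x - p.F x *ᵥ u)) i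
      + ∑ j, (u * ((p.F x)ᵀ *ᵥ l + p.Eᵀ *ᵥ β)) j ≤ 0 := by
    change l ⬝ᵥ (p.h + p.G *ᵥ x - p.F x *ᵥ u) + u ⬝ᵥ ((p.F x)ᵀ *ᵥ l + p.Eᵀ *ᵥ β) ≤ 0
    rw [dotProduct_sub, Matrix.dotProduct_mulVec, Matrix.mulVec_transpose, dotProduct_comm u,
      add_dotProduct]
    rw [neg_dotProduct, dotProduct_comm _ l] at hv
    linarith
  have s1 := Finset.sum_nonneg fun i (_ : i ∈ Finset.univ) => n1 i
  have s2 := Finset.sum_nonneg fun i (_ : i ∈ Finset.univ) => n2 i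
  refine ⟨(u, l), hu.2, neg_le_iff_add_nonneg.2 hd', ?_, ?_, hu.1, hl⟩
  · ext i
    exact (Finset.sum_eq_zero_iff_of_nonneg fun i _ => n1 i).1 (by linarith) i (Finset.mem_univ i)
  · ext i
    exact (Finset.sum_eq_zero_iff_of_nonneg fun i _ => n2 i).1 (by linarith) i (Finset.mem_univ i)

/-! ### The recourse problem -/

theorem rhs_dotProduct_le_of_mem_Y {x : Fin mx ⊕ Fin nx → ℝ} {u : Fin nu → ℝ}
    {y : Fin ny → ℝ} {π : Fin μy → ℝ} (hy : y ∈ p.Y x u) (hπ : π ∈ p.dualSet) :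
    p.rhs x u ⬝ᵥ π ≤ p.c₂ ⬝ᵥ y :=
  weak_duality p.B₂ (p.rhs x u) p.c₂ hy.1 hy.2 hπ.1 hπ.2

theorem rhs_dotProduct_nonpos_of_mem_Y {x : Fin mx ⊕ Fin nx → ℝ} {u : Fin nu → ℝ}
    {y : Fin ny → ℝ} {γ : Fin μy → ℝ} (hy : y ∈ p.Y x u) (hγ : γ ∈ p.recCone) :
    p.rhs x u ⬝ᵥ γ ≤ 0 := by
  simpa using weak_duality p.B₂ (p.rhs x u) 0 hy.1 hy.2 hγ.1 hγ.2

theorem rhs_dotProduct_le_recourse {x : Fin mx ⊕ Fin nx → ℝ} {u : Fin nu → ℝ}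
    {π : Fin μy → ℝ} (hπ : π ∈ p.dualSet) :
    ((p.rhs x u ⬝ᵥ π : ℝ) : EReal) ≤ p.recourse x u :=
  le_iInf₂ fun _ hy => EReal.coe_le_coe_iff.2 (rhs_dotProduct_le_of_mem_Y hy hπ)

theorem dualSet_nonempty (hA3 : p.A3) : p.dualSet.Nonempty := by
  obtain ⟨⟨_, x, hx, u, hu, y₀, hy₀, -⟩, l, hl⟩ := hA3
  obtain ⟨π, h1, h2, -⟩ := exists_dual_of_forall_le p.B₂ (p.rhs x u) p.c₂ hy₀.1 hy₀.2
    (l - p.c₁ ⬝ᵥ x) fun y h0 h1 => by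
      linarith [hl ⟨x, hx, u, hu, y, ⟨h0, h1⟩, rfl⟩]
  exact ⟨π, h1, h2⟩

/-- A feasible recourse problem has an optimal dual solution that is an extreme point. -/
theorem exists_extPts_eq_recourse (hne : p.dualSet.Nonempty) {x : Fin mx ⊕ Fin nx → ℝ}
    {u : Fin nu → ℝ} (hY : (p.Y x u).Nonempty) :
    ∃ π ∈ p.extPts, ((p.rhs x u ⬝ᵥ π : ℝ) : EReal) = p.recourse x u := by
  obtain ⟨π₀, hπ₀⟩ := hne
  obtain ⟨y₀, hy₀⟩ := hY
  obtain ⟨v, hv⟩ : ∃ v : ℝ, (v : EReal) = p.recourse x u :=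
    ⟨_, EReal.coe_toReal (ne_top_of_le_ne_top (EReal.coe_ne_top _) (iInf₂_le y₀ hy₀))
      (ne_bot_of_le_ne_bot (EReal.coe_ne_bot _) (rhs_dotProduct_le_recourse hπ₀))⟩
  have hle : ∀ π ∈ p.dualSet, p.rhs x u ⬝ᵥ π ≤ v := fun π hπ =>
    EReal.coe_le_coe_iff.1 (hv ▸ rhs_dotProduct_le_recourse hπ)
  obtain ⟨π₁, h1, h2, h3⟩ := exists_dual_of_forall_le p.B₂ (p.rhs x u) p.c₂ hy₀.1 hy₀.2 v
    fun y h0 h1 => EReal.coe_le_coe_iff.1 (hv ▸ iInf₂_le y ⟨h0, h1⟩)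
  obtain ⟨π, hπ, he⟩ := p.exists_extPts_eq (p.rhs x u) (π₀ := π₁) ⟨h1, h2⟩ fun π hπ =>
    (hle π hπ).trans h3
  refine ⟨π, hπ, ?_⟩
  rw [he, ← hv, (hle π₁ ⟨h1, h2⟩).antisymm h3]

/-- The worst case of a feasible first-stage decision is attained, with an extreme point as optimal
dual solution. -/
theorem exists_eq_worstCase (hA1 : p.A1) (hA2 : p.A2) (hne : p.dualSet.Nonempty)
    {x : Fin mx ⊕ Fin nx → ℝ} (hx : p.IsFeasible x) :
    ∃ u ∈ p.U x, ∃ π ∈ p.extPts, p.recourse x u = p.worstCase x ∧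
      ((p.rhs x u ⬝ᵥ π : ℝ) : EReal) = p.worstCase x := by
  have hmax : ∀ π : Fin μy → ℝ, ∃ u ∈ p.U x, ∀ u' ∈ p.U x,
      p.rhs x u' ⬝ᵥ π ≤ p.rhs x u ⬝ᵥ π := fun π => by
    obtain ⟨q, hq⟩ := kkt_nonempty hA1 hA2 hx.1 π
    exact ⟨q.1, kkt_mem_U hq, fun _ => rhs_dotProduct_le_of_kkt hq⟩
  choose m hmU hm using hmax
  obtain ⟨u₀, hu₀⟩ := hA1 x hx.1
  obtain ⟨π₀, hπ₀, -⟩ := exists_extPts_eq_recourse hne (hx.2 u₀ hu₀)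
  -- The two maxima are exchanged: first over scenarios for fixed `π`, then over the finitely many
  -- extreme points.
  obtain ⟨π, hπ, hbest⟩ := p.extPts.exists_max_image (fun π => p.rhs x (m π) ⬝ᵥ π)
    p.extPts_finite_and_ncard_le.1 ⟨π₀, hπ₀⟩
  have hub : p.worstCase x ≤ ((p.rhs x (m π) ⬝ᵥ π : ℝ) : EReal) := iSup₂_le fun u hu => by
    obtain ⟨π', hπ', he⟩ := exists_extPts_eq_recourse hne (hx.2 u hu)
    rw [← he]
    exact EReal.coe_le_coe_iff.2 ((hm π' u hu).trans (hbest π' hπ'))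
  have h1 : ((p.rhs x (m π) ⬝ᵥ π : ℝ) : EReal) ≤ p.recourse x (m π) :=
    rhs_dotProduct_le_recourse hπ.1
  have h2 : p.recourse x (m π) ≤ p.worstCase x := le_iSup₂_of_le (m π) (hmU π) le_rfl
  exact ⟨m π, hmU π, π, hπ, h2.antisymm (hub.trans h1), (h1.trans h2).antisymm hub⟩

/-! ### The feasibility subproblem -/

theorem rhs_dotProduct_le_violation {x : Fin mx ⊕ Fin nx → ℝ} {u : Fin nu → ℝ}
    {γ : Fin μy → ℝ} (hγ : γ ∈ p.recCone) (h1 : γ ≤ 1) :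
    ((p.rhs x u ⬝ᵥ γ : ℝ) : EReal) ≤ p.violation x u := by
  refine le_iInf₂ fun q hq => EReal.coe_le_coe_iff.2 ?_
  -- Subtracting the slack from `d` makes `q.1` a genuine recourse solution of a modified problem
  -- with the same recession cone.
  have h2 := rhs_dotProduct_nonpos_of_mem_Y (p := { p with d := p.d - q.2 }) (x := x) (u := u)
    (y := q.1) (γ := γ) ⟨hq.1, by
      have := sub_le_iff_le_add.2 hq.2.2
      refine le_trans (le_of_eq ?_) this
      simp only [rhs]; abel⟩ hγ
  have h3 : q.2 ⬝ᵥ γ ≤ ∑ i, q.2 i := Finset.sum_le_sum fun i _ =>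
    mul_le_of_le_one_right (hq.2.1 i) (h1 i)
  have h4 : p.rhs x u ⬝ᵥ γ =
      ({ p with d := p.d - q.2 } : Problem mx nx kx nu μu ny μy).rhs x u ⬝ᵥ γ + q.2 ⬝ᵥ γ := by
    rw [← add_dotProduct]; congr 1; simp only [rhs]; abel
  linarith

theorem violation_nonneg (x : Fin mx ⊕ Fin nx → ℝ) (u : Fin nu → ℝ) : 0 ≤ p.violation x u :=
  le_iInf₂ fun _ hq => EReal.coe_nonneg.2 (Finset.sum_nonneg fun i _ => hq.2.1 i)

theorem violation_eq_zero {x : Fin mx ⊕ Fin nx → ℝ} {u : Fin nu → ℝ} (h : (p.Y x u).Nonempty) :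
    p.violation x u = 0 := by
  obtain ⟨y, hy⟩ := h
  refine le_antisymm ((iInf₂_le (y, 0) ⟨hy.1, le_rfl, by simpa using hy.2⟩).trans ?_)
    (violation_nonneg x u)
  simp

/-- The dual of the violation problem maximizes `rhs x u ⬝ᵥ γ` over the recession cone cut by `γ ≤
1`. The primal is always feasible, with slack `|rhs x u|`, and bounded below by `0`, so strong
duality applies. -/
theorem exists_eq_violation (x : Fin mx ⊕ Fin nx → ℝ) (u : Fin nu → ℝ) :
    ∃ γ ∈ p.recCone, γ ≤ 1 ∧ ((p.rhs x u ⬝ᵥ γ : ℝ) : EReal) = p.violation x u := by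
  have hfeas : ((0, |p.rhs x u|) : (Fin ny → ℝ) × (Fin μy → ℝ)) ∈
      {q : (Fin ny → ℝ) × (Fin μy → ℝ) |
        0 ≤ q.1 ∧ 0 ≤ q.2 ∧ p.rhs x u ≤ p.B₂ *ᵥ q.1 + q.2} :=
    ⟨le_rfl, abs_nonneg _, by simpa using le_abs_self (p.rhs x u)⟩
  obtain ⟨v, hv⟩ : ∃ v : ℝ, (v : EReal) = p.violation x u :=
    ⟨_, EReal.coe_toReal (ne_top_of_le_ne_top (EReal.coe_ne_top _) (iInf₂_le _ hfeas))
      (ne_bot_of_le_ne_bot EReal.zero_ne_bot (violation_nonneg x u))⟩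
  obtain ⟨γ, h0, h1, h2⟩ := exists_dual_of_forall_le
    (Matrix.fromCols p.B₂ (1 : Matrix (Fin μy) (Fin μy) ℝ)) (p.rhs x u)
    (Sum.elim (0 : Fin ny → ℝ) (1 : Fin μy → ℝ)) (y₀ := Sum.elim 0 |p.rhs x u|)
    (by rintro (j | i); exacts [le_rfl, abs_nonneg (p.rhs x u i)])
    (by rw [Matrix.fromCols_mulVec_sumElim]; simpa using le_abs_self (p.rhs x u)) v
    fun y hy hMy => by
      rw [← Sum.elim_comp_inl_inr y, Matrix.fromCols_mulVec_sumElim, Matrix.one_mulVec] at hMy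
      have hle : p.violation x u ≤ ((∑ i, (y ∘ Sum.inr) i : ℝ) : EReal) :=
        iInf₂_le (y ∘ Sum.inl, y ∘ Sum.inr) ⟨fun j => hy _, fun i => hy _, hMy⟩
      have := EReal.coe_le_coe_iff.1 (hv ▸ hle)
      simpa [dotProduct] using this
  rw [Matrix.transpose_fromCols, Matrix.fromRows_mulVec, Matrix.transpose_one,
    Matrix.one_mulVec] at h1
  have hγ : γ ∈ p.recCone := ⟨h0, fun j => h1 (.inl j)⟩
  have hγ1 : γ ≤ 1 := fun i => h1 (.inr i)
  exact ⟨γ, hγ, hγ1, (rhs_dotProduct_le_violation hγ hγ1).antisymm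
    (hv ▸ EReal.coe_le_coe_iff.2 h2)⟩

/-- The worst-case violation is attained. -/
theorem exists_eq_worstViolation (hA1 : p.A1) (hA2 : p.A2) {x : Fin mx ⊕ Fin nx → ℝ}
    (hx : x ∈ p.X) : ∃ u ∈ p.U x, ∃ γ ∈ p.recCone, p.violation x u = p.worstViolation x ∧
      ((p.rhs x u ⬝ᵥ γ : ℝ) : EReal) = p.worstViolation x := by
  have hbox : IsCompact {γ | γ ∈ p.recCone ∧ γ ≤ 1} :=
    (isCompact_Icc (a := (0 : Fin μy → ℝ)) (b := 1)).of_isClosed_subset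
      (p.isClosed_recCone.inter (isClosed_le continuous_id continuous_const))
      fun γ hγ => ⟨hγ.1.1, hγ.2⟩
  obtain ⟨u₀, hu₀⟩ := hA1 x hx
  obtain ⟨γ₀, hγ₀, hγ₀1, -⟩ := exists_eq_violation (p := p) x u₀
  obtain ⟨⟨u, γ⟩, ⟨hu, hγ, hγ1⟩, hmax⟩ := ((isCompact_U hA2 hx).prod hbox).exists_isMaxOn
    ⟨(u₀, γ₀), hu₀, hγ₀, hγ₀1⟩ (p.continuous_rhs_dotProduct x).continuousOn
  have hub : p.worstViolation x ≤ ((p.rhs x u ⬝ᵥ γ : ℝ) : EReal) := iSup₂_le fun u' hu' => by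
    obtain ⟨γ', hγ', hγ'1, he⟩ := exists_eq_violation (p := p) x u'
    rw [← he]
    exact EReal.coe_le_coe_iff.2 (hmax (a := (u', γ')) ⟨hu', hγ', hγ'1⟩)
  have h1 : ((p.rhs x u ⬝ᵥ γ : ℝ) : EReal) ≤ p.violation x u := rhs_dotProduct_le_violation hγ hγ1
  have h2 : p.violation x u ≤ p.worstViolation x := le_iSup₂_of_le u hu le_rfl
  exact ⟨u, hu, γ, hγ, h2.antisymm (hub.trans h1), (h1.trans h2).antisymm hub⟩

theorem worstViolation_nonneg (hA1 : p.A1) {x : Fin mx ⊕ Fin nx → ℝ} (hx : x ∈ p.X) :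
    0 ≤ p.worstViolation x := by
  obtain ⟨u, hu⟩ := hA1 x hx
  exact le_iSup₂_of_le u hu (violation_nonneg x u)

theorem worstViolation_nonpos {x : Fin mx ⊕ Fin nx → ℝ} (hx : p.IsFeasible x) :
    p.worstViolation x ≤ 0 :=
  iSup₂_le fun u hu => (violation_eq_zero (hx.2 u hu)).le

/-- A first-stage decision without violation is feasible. -/
theorem isFeasible_of_worstViolation_eq_zero {x : Fin mx ⊕ Fin nx → ℝ} (hx : x ∈ p.X)
    (h : p.worstViolation x = 0) : p.IsFeasible x := by
  refine ⟨hx, fun u hu => ?_⟩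
  by_contra hY
  obtain ⟨γ₀, h0, h1, h2⟩ := exists_ray_of_infeasible p.B₂ (p.rhs x u) fun y h0 h1 =>
    hY ⟨y, h0, h1⟩
  obtain ⟨γ, hγ, hpos⟩ := p.exists_extRays_pos (p.rhs x u) (γ₀ := γ₀) ⟨h0, h1⟩ h2
  -- Coordinate sum `1` places the ray in the box where it bounds the violation from below.
  have hγ1 : γ ≤ 1 := fun i => by
    rw [Pi.one_apply, ← hγ.2]
    exact Finset.single_le_sum (fun j _ => hγ.1.1.1 j) (Finset.mem_univ i)
  have h3 : ((p.rhs x u ⬝ᵥ γ : ℝ) : EReal) ≤ p.worstViolation x :=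
    (rhs_dotProduct_le_violation hγ.1.1 hγ1).trans (le_iSup₂_of_le u hu le_rfl)
  rw [h] at h3
  exact absurd (EReal.coe_nonpos.1 h3) (not_le.2 hpos)

/-! ### Bounds -/

theorem worstCase_eq_top {x : Fin mx ⊕ Fin nx → ℝ} (hx : x ∈ p.X) (h : ¬ p.IsFeasible x) :
    p.worstCase x = ⊤ := by
  simp only [IsFeasible, not_and, not_forall, Set.not_nonempty_iff_eq_empty] at h
  obtain ⟨u, hu, hY⟩ := h hx
  refine top_le_iff.1 (le_iSup₂_of_le u hu ?_)
  simp [recourse, hY]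

theorem cost_eq_top {x : Fin mx ⊕ Fin nx → ℝ} (hx : x ∈ p.X) (h : ¬ p.IsFeasible x) :
    p.cost x = ⊤ := by
  rw [cost, worstCase_eq_top hx h, EReal.coe_add_top]

theorem isFeasible_of_cost_ne_top {x : Fin mx ⊕ Fin nx → ℝ} (hx : x ∈ p.X)
    (h : p.cost x ≠ ⊤) : p.IsFeasible x :=
  not_not.1 fun hf => h (cost_eq_top hx hf)

theorem optVal_le_cost {x : Fin mx ⊕ Fin nx → ℝ} (hx : x ∈ p.X) : p.optVal ≤ p.cost x :=
  iInf₂_le x hx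

theorem coe_le_optVal (hA1 : p.A1) {l : ℝ} (hl : l ∈ lowerBounds p.jointValues) :
    (l : EReal) ≤ p.optVal := by
  refine le_iInf₂ fun x hx => ?_
  obtain ⟨u, hu⟩ := hA1 x hx
  have h1 : ((l - p.c₁ ⬝ᵥ x : ℝ) : EReal) ≤ p.worstCase x :=
    le_iSup₂_of_le u hu (le_iInf₂ fun y hy => EReal.coe_le_coe_iff.2 (by
      linarith [hl ⟨x, hx, u, hu, y, hy, rfl⟩]))
  calc (l : EReal) = ((p.c₁ ⬝ᵥ x : ℝ) : EReal) + ((l - p.c₁ ⬝ᵥ x : ℝ) : EReal) := by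
        rw [← EReal.coe_add]; congr 1; ring
    _ ≤ _ := add_le_add le_rfl h1

/-- A single extreme-point replicate is a jointly feasible triple whose cost bounds the master
objective from below. Hence the master problem can be unbounded only while `P` is empty. -/
theorem coe_le_masterVal {unified : Prop} {P R : Set (Fin μy → ℝ)} {l : ℝ}
    (hl : l ∈ lowerBounds p.jointValues) {π : Fin μy → ℝ} (hπ : π ∈ P) :
    (l : EReal) ≤ p.masterVal unified P R := by
  refine le_iInf₂ fun z hz => EReal.coe_le_coe_iff.2 ?_
  obtain ⟨h1, h2, h3⟩ := hz.2.1 π hπ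
  have := hl ⟨z.x, hz.1, z.u π, kkt_mem_U h3, z.y π, h2, rfl⟩
  unfold masterObj
  linarith

/-- A feasible first-stage decision extends to the master problem, with `η` any upper bound of its
worst-case recourse cost. -/
theorem exists_mem_masterSet (hA1 : p.A1) (hA2 : p.A2) (unified : Prop) (P R : Set (Fin μy → ℝ))
    {x : Fin mx ⊕ Fin nx → ℝ} (hx : x ∈ p.X) {η : ℝ} (hη : p.worstCase x < η) :
    ∃ z ∈ p.masterSet unified P R, z.x = x ∧ z.η = η := by
  have hY : ∀ u, ∃ y, u ∈ p.U x → y ∈ p.Y x u ∧ p.c₂ ⬝ᵥ y ≤ η := fun u => by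
    by_cases hu : u ∈ p.U x
    -- Strictness yields an actual `y` below `η` without invoking attainment of the recourse
    -- infimum.
    · have h1 : p.recourse x u < η := lt_of_le_of_lt (le_iSup₂_of_le u hu le_rfl) hη
      simp only [recourse, iInf_lt_iff] at h1
      obtain ⟨y, hy, hlt⟩ := h1
      exact ⟨y, fun _ => ⟨hy, (EReal.coe_lt_coe_iff.1 hlt).le⟩⟩
    · exact ⟨0, fun h => absurd h hu⟩
  choose y hy using hY
  choose q hq using fun β => kkt_nonempty hA1 hA2 hx β
  have h β := hy (q β).1 (kkt_mem_U (hq β))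
  exact ⟨⟨x, η, fun β => (q β).1, fun β => (q β).2, fun β => y (q β).1, fun β => (q β).1,
    fun β => (q β).2, fun β => y (q β).1⟩,
    ⟨hx, fun β _ => ⟨(h β).2, (h β).1, hq β⟩, fun β _ => ⟨fun _ => (h β).2, (h β).1, hq β⟩⟩,
    rfl, rfl⟩

theorem infeasible_of_masterSet_eq_empty (hA1 : p.A1) (hA2 : p.A2) (hne : p.dualSet.Nonempty)
    {unified : Prop} {P R : Set (Fin μy → ℝ)} (h : p.masterSet unified P R = ∅) :
    p.Infeasible := fun x hx => by
  obtain ⟨u, -, π, -, -, he⟩ := exists_eq_worstCase hA1 hA2 hne hx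
  obtain ⟨z, hz, -⟩ := exists_mem_masterSet hA1 hA2 unified P R hx.1
    (η := p.rhs x u ⬝ᵥ π + 1) (by rw [← he]; exact EReal.coe_lt_coe_iff.2 (lt_add_one _))
  rw [h] at hz
  exact hz

/-- The master problem is a relaxation of the two-stage problem. -/
theorem masterVal_le_optVal (hA1 : p.A1) (hA2 : p.A2) (hne : p.dualSet.Nonempty)
    (unified : Prop) (P R : Set (Fin μy → ℝ)) : p.masterVal unified P R ≤ p.optVal := by
  refine le_iInf₂ fun x hx => ?_
  by_cases hf : p.IsFeasible x
  · obtain ⟨u, -, π, -, -, he⟩ := exists_eq_worstCase hA1 hA2 hne hf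
    -- The extension needs `η` strictly above the worst case, so the bound is proved for every real
    -- `w` above the cost.
    rw [cost, ← he, ← EReal.coe_add, ← EReal.le_of_forall_lt_iff_le]
    intro w hw
    have hw := EReal.coe_lt_coe_iff.1 hw
    obtain ⟨z, hz, hzx, hzη⟩ := exists_mem_masterSet hA1 hA2 unified P R hx
      (η := w - p.c₁ ⬝ᵥ x) (by rw [← he]; exact EReal.coe_lt_coe_iff.2 (by linarith))
    refine (iInf₂_le z hz).trans (EReal.coe_le_coe_iff.2 (le_of_eq ?_))
    rw [masterObj, hzx, hzη]
    ring
  · rw [cost_eq_top hx hf]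
    exact le_top

theorem masterVal_ne_top {unified : Prop} {P R : Set (Fin μy → ℝ)}
    {z : MasterPoint mx nx nu μu ny μy} (hz : z ∈ p.masterSet unified P R) :
    p.masterVal unified P R ≠ ⊤ :=
  ne_top_of_le_ne_top (EReal.coe_ne_top _) (iInf₂_le z hz)

/-- Infinite bounds need no separate treatment in the stopping test, because the right-hand side `0`
is finite. -/
theorem sub_le_coe_zero_iff {a b : EReal} : a - b ≤ ((0 : ℝ) : EReal) ↔ a ≤ b := by
  rw [EReal.sub_le_iff_le_add (Or.inr (EReal.coe_ne_top _)) (Or.inr (EReal.coe_ne_bot _)),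
    EReal.coe_zero, zero_add]

/-! ### The subproblem phase -/

theorem Subproblem.optVal_le {x : Fin mx ⊕ Fin nx → ℝ} {P R P' R' : Set (Fin μy → ℝ)}
    {η : EReal} (hx : x ∈ p.X) (h : p.Subproblem x P R η P' R') :
    p.optVal ≤ ((p.c₁ ⬝ᵥ x : ℝ) : EReal) + η := by
  cases h with
  | caseA => exact optVal_le_cost hx
  | caseB => rw [EReal.coe_add_top]; exact le_top

theorem Subproblem.isFeasible_and_cost_eq {x : Fin mx ⊕ Fin nx → ℝ} {P R P' R' : Set (Fin μy → ℝ)}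
    {η : EReal} (hx : x ∈ p.X) (h : p.Subproblem x P R η P' R')
    (hne : ((p.c₁ ⬝ᵥ x : ℝ) : EReal) + η ≠ ⊤) :
    p.IsFeasible x ∧ p.cost x = ((p.c₁ ⬝ᵥ x : ℝ) : EReal) + η := by
  cases h with
  | caseA => exact ⟨isFeasible_of_cost_ne_top hx hne, rfl⟩
  | caseB => exact absurd (EReal.coe_add_top _) hne

theorem exists_subproblem (hA1 : p.A1) (hA2 : p.A2) (hne : p.dualSet.Nonempty)
    {x : Fin mx ⊕ Fin nx → ℝ} (hx : x ∈ p.X) (P R : Set (Fin μy → ℝ)) :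
    ∃ η P' R', p.Subproblem x P R η P' R' := by
  rcases (worstViolation_nonneg hA1 hx).eq_or_lt with h0 | h0
  · obtain ⟨u, hu, π, hπ, h1, h2⟩ := exists_eq_worstCase hA1 hA2 hne
      (isFeasible_of_worstViolation_eq_zero hx h0.symm)
    exact ⟨_, _, _, .caseA u π h0.symm hu h1 hπ h2⟩
  · obtain ⟨u, hu, γ₀, hγ₀, h1, h2⟩ := exists_eq_worstViolation hA1 hA2 hx
    rw [← h2, EReal.coe_pos] at h0
    obtain ⟨γ, hγ, hpos⟩ := p.exists_extRays_pos (p.rhs x u) hγ₀ h0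
    exact ⟨_, _, _, .caseB u γ (by rw [← h2]; exact EReal.coe_pos.2 h0) hu h1 hγ hpos⟩

/-- Unless the bounds meet, the subproblem phase finds a new extreme point or a new extreme ray. -/
theorem Subproblem.new {unified : Prop} (hA3 : p.A3) {P R P' R' : Set (Fin μy → ℝ)}
    {z : MasterPoint mx nx nu μu ny μy} {η UB : EReal} (hM : p.MasterReturns unified P R z)
    (h : p.Subproblem z.x P R η P' R')
    (hgap : ¬ min UB (((p.c₁ ⬝ᵥ z.x : ℝ) : EReal) + η) ≤ p.masterVal unified P R) :
    (∃ π ∈ p.extPts, π ∉ P ∧ P' = insert π P ∧ R' = R) ∨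
      (∃ γ ∈ p.extRays, γ ∉ R ∧ P' = P ∧ R' = insert γ R ∧ ¬ p.IsFeasible z.x) := by
  cases h with
  | caseA u π hf hu hopt hπ hdual =>
    -- A repeated `π` would give `rhs x u ⬝ᵥ π ≤ rhs x u^π ⬝ᵥ π ≤ c₂ y^π ≤ η`. Since `π ∈ P`
    -- excludes value `⊥`, `z` is optimal, and the upper bound would not exceed the master value.
    refine Or.inl ⟨π, hπ, fun hmem => hgap ((min_le_right _ _).trans ?_), rfl, rfl⟩
    obtain ⟨l, hl⟩ := hA3.2
    have hbot : p.masterVal unified P R ≠ ⊥ :=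
      ne_bot_of_le_ne_bot (EReal.coe_ne_bot l) (coe_le_masterVal hl hmem)
    rw [← hM.2.resolve_left hbot, ← hdual, ← EReal.coe_add, EReal.coe_le_coe_iff, masterObj]
    obtain ⟨h1, h2, h3⟩ := hM.1.2.1 π hmem
    have h4 := rhs_dotProduct_le_of_kkt h3 hu
    have h5 := rhs_dotProduct_le_of_mem_Y h2 hπ.1
    simp only at h4
    linarith
  | caseB u γ hf hu hopt hγ hray =>
    -- For a repeated `γ`, the replicate scenario is worst for `γ` yet has a recourse solution,
    -- which forces `rhs x u ⬝ᵥ γ ≤ 0`.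
    refine Or.inr ⟨γ, hγ, fun hmem => ?_, rfl, rfl, fun hfeas =>
      absurd hf (not_lt.2 (worstViolation_nonpos hfeas))⟩
    obtain ⟨-, h2, h3⟩ := hM.1.2.2 γ hmem
    have h4 := rhs_dotProduct_le_of_kkt h3 hu
    have h5 := rhs_dotProduct_nonpos_of_mem_Y h2 hγ.1.1
    simp only at h4
    linarith

/-! ### Invariants -/

/-- The upper bound is valid, and attained by the recorded decision once it is finite. -/
structure UpperBoundInvariant (p : Problem mx nx kx nu μu ny μy) (UB : EReal)
    (best : Option (Fin mx ⊕ Fin nx → ℝ)) : Prop where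
  optVal_le : p.optVal ≤ UB
  exists_best : UB ≠ ⊤ → ∃ x, best = some x
  attained : ∀ x, best = some x → UB ≠ ⊤ → p.IsFeasible x ∧ p.cost x = UB

theorem UpperBoundInvariant.update {UB w : EReal} {best best' : Option (Fin mx ⊕ Fin nx → ℝ)}
    {x : Fin mx ⊕ Fin nx → ℝ} (h : p.UpperBoundInvariant UB best)
    (hb : BestUpdate UB best x w best') (hw : p.optVal ≤ w)
    (hx : w ≠ ⊤ → p.IsFeasible x ∧ p.cost x = w) : p.UpperBoundInvariant (min UB w) best' := by
  rcases hb with ⟨hle, rfl⟩ | ⟨hle, rfl⟩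
  · rw [min_eq_right hle]
    exact ⟨hw, fun _ => ⟨x, rfl⟩, fun x' hx' hne => Option.some_injective _ hx' ▸ hx hne⟩
  · rwa [min_eq_left hle]

/-- Bounds for the number `k` of completed iterations. -/
def IterationBound (p : Problem mx nx kx nu μu ny μy) (k : ℕ) : Prop :=
  k ≤ p.extPts.ncard + p.extRays.ncard ∧ ((∀ x ∈ p.X, p.IsFeasible x) → k ≤ p.extPts.ncard)

/-- `k_eq` turns the iteration count into a cardinality. No invariant on `LB` is needed, since it is
recomputed from the master problem in each iteration. -/
structure StateInvariant (p : Problem mx nx kx nu μu ny μy) (s : State mx nx μy) : Prop where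
  upper : p.UpperBoundInvariant s.UB s.best
  P_subset : s.P ⊆ p.extPts
  R_subset : s.R ⊆ p.extRays
  k_eq : s.k = s.P.ncard + s.R.ncard
  R_empty : (∀ x ∈ p.X, p.IsFeasible x) → s.R = ∅

theorem StateInvariant.iterationBound {s : State mx nx μy} (h : p.StateInvariant s) :
    p.IterationBound s.k := by
  have h1 := Set.ncard_le_ncard h.P_subset p.extPts_finite_and_ncard_le.1
  have h2 := Set.ncard_le_ncard h.R_subset p.extRays_finite_and_ncard_le.1
  refine ⟨by rw [h.k_eq]; exact add_le_add h1 h2, fun hf => ?_⟩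
  rw [h.k_eq, h.R_empty hf, Set.ncard_empty]
  exact h1

theorem stateInvariant_init : p.StateInvariant ⟨0, ⊥, ⊤, none, ∅, ∅⟩ where
  upper := ⟨le_top, fun h => absurd rfl h, fun _ h => by simp at h⟩
  P_subset := Set.empty_subset _
  R_subset := Set.empty_subset _
  k_eq := by simp
  R_empty _ := rfl

theorem StateInvariant.proceed (hA3 : p.A3) {unified : Prop} {s : State mx nx μy}
    (h : p.StateInvariant s) {z : MasterPoint mx nx nu μu ny μy} {η LB : EReal}
    {best : Option (Fin mx ⊕ Fin nx → ℝ)} {P' R' : Set (Fin μy → ℝ)}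
    (hM : p.MasterReturns unified s.P s.R z) (hS : p.Subproblem z.x s.P s.R η P' R')
    (hbest : BestUpdate s.UB s.best z.x (((p.c₁ ⬝ᵥ z.x : ℝ) : EReal) + η) best)
    (hgap : ¬ min s.UB (((p.c₁ ⬝ᵥ z.x : ℝ) : EReal) + η) ≤ p.masterVal unified s.P s.R) :
    p.StateInvariant
      ⟨s.k + 1, LB, min s.UB (((p.c₁ ⬝ᵥ z.x : ℝ) : EReal) + η), best, P', R'⟩ := by
  have hu := h.upper.update hbest (hS.optVal_le hM.1.1) (hS.isFeasible_and_cost_eq hM.1.1)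
  have hP := p.extPts_finite_and_ncard_le.1.subset h.P_subset
  have hR := p.extRays_finite_and_ncard_le.1.subset h.R_subset
  rcases hS.new hA3 hM hgap with ⟨π, hπ, hnew, rfl, rfl⟩ | ⟨γ, hγ, hnew, rfl, rfl, hinf⟩
  · exact ⟨hu, Set.insert_subset hπ h.P_subset, h.R_subset, by
      simp only [Set.ncard_insert_of_notMem hnew hP, h.k_eq]; omega, h.R_empty⟩
  · exact ⟨hu, h.P_subset, Set.insert_subset hγ h.R_subset, by
      simp only [Set.ncard_insert_of_notMem hnew hR, h.k_eq]; omega,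
      fun hf => absurd (hf _ hM.1.1) hinf⟩

/-- What holds in every configuration that the algorithm reaches. -/
def ConfigInvariant (p : Problem mx nx kx nu μu ny μy) : Config mx nx μy → Prop
  | .running s => p.StateInvariant s
  | .reportInfeasible k => p.Infeasible ∧ p.IterationBound k
  | .solved k LB UB x => (LB = p.optVal ∧ UB = p.optVal ∧ (∃ w : ℝ, p.optVal = w) ∧
      p.IsOptimal x) ∧ p.IterationBound k

theorem ConfigInvariant.iterationBound {c : Config mx nx μy} (h : p.ConfigInvariant c) :
    p.IterationBound c.iterations := by
  cases c with
  | running s => exact StateInvariant.iterationBound h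
  | reportInfeasible k => exact h.2
  | solved k LB UB x => exact h.2

theorem ConfigInvariant.step (hA1 : p.A1) (hA2 : p.A2) (hA3 : p.A3) {unified : Prop}
    {c c' : Config mx nx μy} (h : p.ConfigInvariant c) (hs : p.Step unified 0 c c') :
    p.ConfigInvariant c' := by
  have hne := dualSet_nonempty hA3
  cases hs with
  | infeasible s hM =>
    exact ⟨infeasible_of_masterSet_eq_empty hA1 hA2 hne hM, StateInvariant.iterationBound h⟩
  | proceed s z η LB' UB' best' P' R' hM hLB hS hUB hbest hgap =>
    subst hLB hUB
    rw [sub_le_coe_zero_iff] at hgap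
    exact StateInvariant.proceed hA3 h hM hS hbest hgap
  | terminate s z η LB' UB' x P' R' hM hLB hS hUB hbest hgap =>
    subst hLB hUB
    rw [sub_le_coe_zero_iff] at hgap
    have hu := (StateInvariant.upper h).update hbest (hS.optVal_le hM.1.1)
      (hS.isFeasible_and_cost_eq hM.1.1)
    -- Squeeze: master value ≤ `optVal` ≤ `UB` ≤ master value. The common value is below `⊤` because
    -- the master problem is feasible, and above `⊥` by the joint lower bound.
    have hlow := masterVal_le_optVal hA1 hA2 hne unified s.P s.R
    have hUB := (hgap.trans hlow).antisymm hu.optVal_le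
    have hLB := hlow.antisymm (hu.optVal_le.trans hgap)
    have htop := masterVal_ne_top hM.1
    obtain ⟨l, hl⟩ := hA3.2
    have hbot := ne_bot_of_le_ne_bot (EReal.coe_ne_bot l) (coe_le_optVal hA1 hl)
    obtain ⟨hf, hc⟩ := hu.attained x rfl (ne_top_of_le_ne_top htop hgap)
    exact ⟨⟨hLB, hUB, ⟨_, (EReal.coe_toReal (hLB ▸ htop) hbot).symm⟩, hf, hc.trans hUB⟩,
      StateInvariant.iterationBound h⟩

theorem Reaches.configInvariant (hA1 : p.A1) (hA2 : p.A2) (hA3 : p.A3) {unified : Prop}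
    {c : Config mx nx μy} (h : p.Reaches unified 0 c) : p.ConfigInvariant c := by
  induction h with
  | refl => exact stateInvariant_init
  | tail _ hs ih => exact ih.step hA1 hA2 hA3 hs

/-! ### Progress and termination -/

theorem StateInvariant.exists_step (hA1 : p.A1) (hA2 : p.A2) (hA3 : p.A3) {unified : Prop}
    {s : State mx nx μy} (h : p.StateInvariant s) (hM : p.MasterSolvable unified s.P s.R) :
    ∃ c, p.Step unified 0 (.running s) c := by
  rcases hM with hM | ⟨z, hM⟩
  · exact ⟨_, .infeasible s hM⟩
  obtain ⟨η, P', R', hS⟩ := exists_subproblem hA1 hA2 (dualSet_nonempty hA3) hM.1.1 s.P s.R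
  obtain ⟨best, hbest⟩ : ∃ best, BestUpdate s.UB s.best z.x
      (((p.c₁ ⬝ᵥ z.x : ℝ) : EReal) + η) best := by
    rcases le_total (((p.c₁ ⬝ᵥ z.x : ℝ) : EReal) + η) s.UB with hle | hle
    exacts [⟨_, Or.inl ⟨hle, rfl⟩⟩, ⟨_, Or.inr ⟨hle, rfl⟩⟩]
  by_cases hgap : min s.UB (((p.c₁ ⬝ᵥ z.x : ℝ) : EReal) + η) - p.masterVal unified s.P s.R
      ≤ ((0 : ℝ) : EReal)
  -- A closed gap makes the upper bound smaller than `⊤`, so there is a recorded decision to return.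
  · have hu := h.upper.update hbest (hS.optVal_le hM.1.1) (hS.isFeasible_and_cost_eq hM.1.1)
    obtain ⟨x, rfl⟩ := hu.exists_best
      (ne_top_of_le_ne_top (masterVal_ne_top hM.1) (sub_le_coe_zero_iff.1 hgap))
    exact ⟨_, .terminate s z η _ _ x P' R' hM rfl hS rfl hbest hgap⟩
  · exact ⟨_, .proceed s z η _ _ best P' R' hM rfl hS rfl hbest hgap⟩

theorem Step.exists_running {unified : Prop} {tol : ℝ} {c c' : Config mx nx μy}
    (h : p.Step unified tol c c') : ∃ s, c = .running s := by
  cases h <;> exact ⟨_, rfl⟩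

theorem not_exists_infinite_execution (hA1 : p.A1) (hA2 : p.A2) (hA3 : p.A3) (unified : Prop) :
    ¬ ∃ c : ℕ → Config mx nx μy, c 0 = Config.init mx nx μy ∧
      ∀ n, p.Step unified 0 (c n) (c (n + 1)) := by
  rintro ⟨c, h0, hc⟩
  have hiter : ∀ n, p.Reaches unified 0 (c n) ∧ (c n).iterations = n := fun n => by
    induction n with
    | zero => rw [h0]; exact ⟨.refl, rfl⟩
    | succ n ih =>
      refine ⟨ih.1.tail (hc n), ?_⟩
      have hs := hc n
      -- The next configuration also has a successor, hence is running, so this step is `proceed`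
      -- and raises the count by one.
      obtain ⟨s', hs'⟩ := Step.exists_running (hc (n + 1))
      obtain ⟨s, hs₀⟩ := Step.exists_running hs
      have hk := ih.2
      rw [hs', hs₀] at hs
      rw [hs₀] at hk
      rw [hs']
      cases hs
      exact congrArg (· + 1) hk
  obtain ⟨hr, hn⟩ := hiter (p.extPts.ncard + p.extRays.ncard + 1)
  have := (hr.configInvariant hA1 hA2 hA3).iterationBound.1
  omega

end Problem

end RobustDDU

theorem mainTheorem1 {mx nx kx nu μu ny μy : ℕ}
    (p : RobustDDU.Problem mx nx kx nu μu ny μy)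
    (hA1 : p.A1) (hA2 : p.A2) (hA3 : p.A3) (unified : Prop) :
    -- a report of infeasibility is correct
    (∀ k, p.Reaches unified 0 (.reportInfeasible k) → p.Infeasible) ∧
    -- otherwise the final bounds are the finite optimal value and the solution is optimal
    (∀ k LB UB x, p.Reaches unified 0 (.solved k LB UB x) →
      LB = p.optVal ∧ UB = p.optVal ∧ (∃ w : ℝ, p.optVal = w) ∧ p.IsOptimal x) ∧
    -- the algorithm never gets stuck, unless a master problem has an unattained minimum
    (∀ s, p.Reaches unified 0 (.running s) → p.MasterSolvable unified s.P s.R →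
      ∃ c, p.Step unified 0 (.running s) c) ∧
    -- there is no infinite execution
    (¬ ∃ c : ℕ → RobustDDU.Config mx nx μy, c 0 = RobustDDU.Config.init mx nx μy ∧
      ∀ n, p.Step unified 0 (c n) (c (n + 1))) ∧
    -- the number of iterations before the terminating one
    p.extPts.Finite ∧ p.extRays.Finite ∧
    (∀ c, p.Reaches unified 0 c → c.iterations ≤ p.extPts.ncard + p.extRays.ncard) ∧
    ((p.extPts.ncard + p.extRays.ncard : ℕ) : ℝ) ≤
      (1 + (μy : ℝ) / (ny + 1)) * ((ny + μy).choose μy : ℝ) ∧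
    -- only extreme points count if every first-stage decision is feasible
    ((∀ x ∈ p.X, p.IsFeasible x) →
      ∀ c, p.Reaches unified 0 c → c.iterations ≤ p.extPts.ncard) ∧
    p.extPts.ncard ≤ (ny + μy).choose μy := by
  refine ⟨fun k h => (h.configInvariant hA1 hA2 hA3).1,
    fun k LB UB x h => (h.configInvariant hA1 hA2 hA3).1,
    fun s h hM => RobustDDU.Problem.StateInvariant.exists_step hA1 hA2 hA3
      (h.configInvariant hA1 hA2 hA3) hM,
    RobustDDU.Problem.not_exists_infinite_execution hA1 hA2 hA3 unified,
    p.extPts_finite_and_ncard_le.1, p.extRays_finite_and_ncard_le.1,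
    fun c h => (h.configInvariant hA1 hA2 hA3).iterationBound.1, ?_,
    fun hf c h => (h.configInvariant hA1 hA2 hA3).iterationBound.2 hf,
    p.extPts_finite_and_ncard_le.2⟩
  rw [Nat.cast_add, add_mul, one_mul]
  exact add_le_add (Nat.cast_le.2 p.extPts_finite_and_ncard_le.2) p.extRays_finite_and_ncard_le.2
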